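/- **Setting.** Let $N\ge 1$, let $U\subset\mathbb R^N$ be a bounded domain, $s\in(0,1)$, $\beta\ge 0$, and for $r\in\{p,q\}$ put $r_s^*=\frac{Nr}{N-sr}$ if $N>sr$ and $r_s^*=+\infty$ otherwise. Assume $$1<p<q<\sigma<\sigma+1<p_s^*,\qquad \max\{2,p(\beta+1),q(\beta+1)\}<\sigma,\qquad 2\sigma\le\min\{p(1+\tfrac2N),\,q(1+\tfrac2N),\,p_s^*,\,q_s^*\}.$$ Let $\mathcal K:[0,\infty)\to[0,\infty)$ be continuous, positive on $(0,\infty)$, and such that * (H1) $\mathcal K$ is non-decreasing on $(0,\infty)$; * (H2) $z\mapsto \mathcal K(z)/z^{\beta}$ is non-increasing on $(0,\infty)$. Put $\widehat{\mathcal K}(z)=\int_0^z\mathcal K(t)\,dt$ and, for $r\in\{p,q\}$, $$G_r(w)=\iint_{U\times U}\frac{|w(x)-w(y)|^r}{|x-y|^{N+sr}}\,dx\,dy,\qquad [w]_r^s=\tfrac1r\,G_r(w).$$ Let $W_0^{s,r}(U)$ be the space of all $w\in W^{s,r}(\mathbb R^N)$ with $w=0$ a.e. outside $U$, normed by $\big(\iint_{\mathbb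 R^N\times\mathbb R^N}\frac{|w(x)-w(y)|^r}{|x-y|^{N+sr}}dx\,dy\big)^{1/r}$, and let $Y=W_0^{s,p}(U)\times W_0^{s,q}(U)$. For $(u,v)\in Y$ define $$\varphi(u,v)=\widehat{\mathcal K}([u]_p^s)+\widehat{\mathcal K}([v]_q^s)+\frac1{\sigma^2}\int_U|u|^\sigma|v|^\sigma dx-\frac1\sigma\int_U|u|^\sigma|v|^\sigma\log|uv|\,dx,$$ $$\psi(u,v)=\mathcal K([u]_p^s)\,G_p(u)+\mathcal K([v]_q^s)\,G_q(v)-2\int_U|u|^\sigma|v|^\sigma\log|uv|\,dx,$$ $$d=\inf\{\varphi(u,v):(u,v)\in Y\setminus\{(0,0)\},\ \psi(u,v)=0\},$$ $$d_*(u,v)=\frac{\big(d-\frac1\sigma\int_U|u|^\sigma|v|^\sigma dx\big)\big(\frac1{q(\beta+1)}-\frac1\sigma\big)}{\frac1p-\frac1\sigma}.$$ Consider the system $$u_t+\mathcal K([u]_p^s)\mathcal L_p^su=|v|^\sigma|u|^{\sigma-2}u\log|uv|,\qquad v_t+\mathcal K([v]_q^s)\mathcal L_q^sv=|u|^\sigma|v|^{\sigma-2}v\log|uv|\qquad\text{in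 }U\times[0,T),$$ with $u=v=0$ on $\partial U$ and $u(0)=u_0$, $v(0)=v_0$, where $\mathcal L_r^s$ is the operator with $$\langle\mathcal L_r^su,w\rangle=\iint_{U\times U}\frac{|u(x)-u(y)|^{r-2}(u(x)-u(y))(w(x)-w(y))}{|x-y|^{N+sr}}\,dx\,dy .$$ A *weak solution* on $[0,T)$, $0<T\le\infty$, is a pair with $(u(t),v(t))\in Y$ for all $t\in[0,T)$ such that, for every finite $T'\in(0,T)$, $(u,v)$ is bounded in $Y$ on $[0,T']$ and $u_t,v_t\in L^2(0,T';L^2(U))$; $u(t)=u_0+\int_0^tu_t\,d\tau$ and $v(t)=v_0+\int_0^tv_t\,d\tau$ in $L^2(U)$ for $t\in[0,T)$; for a.e. $t\in(0,T)$ the two equations hold when tested against every $w_1\in W_0^{s,p}(U)$ and every $w_2\in W_0^{s,q}(U)$ respectively; and $$\int_0^t\big(\|u_t(\tau)\|_2^2+\|v_t(\tau)\|_2^2\big)d\tau+\varphi(u(t),v(t))\le\varphi(u_0,v_0)\qquad\text{for all }t\in[0,T).$$ The maximal existence time $T_{\max}$ is the supremum of all $T\in(0,\infty]$ for which there is a weak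 solution on $[0,T)$ with initial data $(u_0,v_0)$. **Theorem 5.1 (finite-time blow-up).** Let $(u_0,v_0)\in Y$ with $\varphi(u_0,v_0)<d_*$ and $\psi(u_0,v_0)<0$, where $d_*=d_*(u_0,v_0)$. Then $T_{\max}<\infty$; moreover $$T_{\max}\le\frac{4(\sigma-1)\big(\|u_0\|_2^2+\|v_0\|_2^2\big)}{\sigma\,\big(d_*-\varphi(u_0,v_0)\big)(\sigma-2)^2}.$$ -/

import Mathlib

open MeasureTheory Set
open scoped ENNReal

noncomputable section

namespace FracKirchhoff

/-- The Euclidean space `ℝᴺ`. -/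
abbrev Space (N : ℕ) : Type := EuclideanSpace ℝ (Fin N)

/-- The Hilbert space `L²(U)`. -/
abbrev L2 {N : ℕ} (U : Set (Space N)) : Type := Lp ℝ 2 (volume.restrict U)

/-- The Gagliardo kernel `|w(x) - w(y)|^p / |x - y|^(N + s p)` at `z = (x, y)`. -/
def gagliardoKernel {N : ℕ} (s p : ℝ) (w : Space N → ℝ) (z : Space N × Space N) : ℝ :=
  |w z.1 - w z.2| ^ p / ‖z.1 - z.2‖ ^ ((N : ℝ) + s * p)

/-- The Gagliardo double integral over `D × D`. -/
def gagliardo {N : ℕ} (D : Set (Space N)) (s p : ℝ) (w : Space N → ℝ) : ℝ :=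
  ∫ z in D ×ˢ D, gagliardoKernel s p w z

/-- Membership in `W₀^{s,p}(U)`, the functions of `W^{s,p}(ℝᴺ)` that vanish almost everywhere
outside `U`. A function on `U` is identified with its extension by zero. -/
def MemW0 {N : ℕ} (U : Set (Space N)) (s p : ℝ) (w : Space N → ℝ) : Prop :=
  MemLp (U.indicator w) (ENNReal.ofReal p) volume ∧
    Integrable (gagliardoKernel s p (U.indicator w)) volume

/-- The norm of `W₀^{s,p}(U)`: the Gagliardo seminorm over `ℝᴺ × ℝᴺ`. -/
def normW0 {N : ℕ} (U : Set (Space N)) (s p : ℝ) (w : Space N → ℝ) : ℝ :=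
  gagliardo univ s p (U.indicator w) ^ (1 / p)

/-- The critical fractional Sobolev exponent `N p / (N - s p)`, or `+∞` if `N ≤ s p`. -/
def criticalExponent (N : ℕ) (s p : ℝ) : EReal :=
  if s * p < N then ((N * p / (N - s * p) : ℝ) : EReal) else ⊤

/-- The data of the Kirchhoff system: the domain, the exponents and the Kirchhoff function
(only its values on `[0, ∞)` matter). -/
structure System (N : ℕ) where
  U : Set (Space N)
  s : ℝ
  p : ℝ
  q : ℝ
  σ : ℝ
  β : ℝ
  K : ℝ → ℝ

namespace System

variable {N : ℕ}

/-- `U` is a bounded domain. -/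
def IsBoundedDomain (S : System N) : Prop :=
  IsOpen S.U ∧ IsConnected S.U ∧ Bornology.IsBounded S.U

/-- The standing conditions on the exponents. -/
def Admissible (S : System N) : Prop :=
  0 < S.s ∧ S.s < 1 ∧ 0 ≤ S.β ∧
  1 < S.p ∧ S.p < S.q ∧ S.q < S.σ ∧ ((S.σ + 1 : ℝ) : EReal) < criticalExponent N S.s S.p ∧
  max 2 (max (S.p * (S.β + 1)) (S.q * (S.β + 1))) < S.σ ∧
  2 * S.σ ≤ S.p * (1 + 2 / N) ∧ 2 * S.σ ≤ S.q * (1 + 2 / N) ∧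
  ((2 * S.σ : ℝ) : EReal) ≤ criticalExponent N S.s S.p ∧
  ((2 * S.σ : ℝ) : EReal) ≤ criticalExponent N S.s S.q

/-- The Kirchhoff function is continuous on `[0, ∞)` and positive on `(0, ∞)`. -/
def IsKirchhoff (S : System N) : Prop :=
  ContinuousOn S.K (Ici 0) ∧ ∀ z, 0 < z → 0 < S.K z

def H1 (S : System N) : Prop := MonotoneOn S.K (Ioi 0)

def H2 (S : System N) : Prop := AntitoneOn (fun z => S.K z / z ^ S.β) (Ioi 0)

/-- The primitive `z ↦ ∫₀ᶻ K`. -/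
def Khat (S : System N) (z : ℝ) : ℝ := ∫ t in (0 : ℝ)..z, S.K t

/-- `(1/r) ∬_{U × U} |w(x) - w(y)|^r / |x - y|^(N + s r)`, for `r = p` or `r = q`. -/
def bracket (S : System N) (r : ℝ) (w : Space N → ℝ) : ℝ :=
  1 / r * gagliardo S.U S.s r w

/-- The energy functional. -/
def energy (S : System N) (u v : Space N → ℝ) : ℝ :=
  S.Khat (S.bracket S.p u) + S.Khat (S.bracket S.q v)
    + 1 / S.σ ^ 2 * (∫ x in S.U, |u x| ^ S.σ * |v x| ^ S.σ)
    - 1 / S.σ * ∫ x in S.U, |u x| ^ S.σ * |v x| ^ S.σ * Real.log |u x * v x|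

/-- The Nehari functional. -/
def nehari (S : System N) (u v : Space N → ℝ) : ℝ :=
  S.K (S.bracket S.p u) * gagliardo S.U S.s S.p u
    + S.K (S.bracket S.q v) * gagliardo S.U S.s S.q v
    - 2 * ∫ x in S.U, |u x| ^ S.σ * |v x| ^ S.σ * Real.log |u x * v x|

/-- The phase space `W₀^{s,p}(U) × W₀^{s,q}(U)`, inside `L²(U) × L²(U)`; for admissible exponents
this is no restriction, the critical exponents being larger than `2`. -/
def phaseSpace (S : System N) : Set (L2 S.U × L2 S.U) :=
  {w | MemW0 S.U S.s S.p w.1 ∧ MemW0 S.U S.s S.q w.2}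

/-- The Nehari manifold. -/
def nehariManifold (S : System N) : Set (L2 S.U × L2 S.U) :=
  {w | w ∈ S.phaseSpace ∧ w ≠ 0 ∧ S.nehari w.1 w.2 = 0}

/-- The depth `d` of the potential well. -/
def depth (S : System N) : ℝ :=
  sInf ((fun w : L2 S.U × L2 S.U => S.energy w.1 w.2) '' S.nehariManifold)

/-- The modified depth `d_*`, which depends on `(u, v)`. -/
def depthStar (S : System N) (u v : Space N → ℝ) : ℝ :=
  (S.depth - 1 / S.σ * ∫ x in S.U, |u x| ^ S.σ * |v x| ^ S.σ)
    * (1 / (S.q * (S.β + 1)) - 1 / S.σ) / (1 / S.p - 1 / S.σ)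

/-- The duality pairing of the (regional) fractional `r`-Laplacian of `u` with `w`. -/
def fracLaplacePairing (S : System N) (r : ℝ) (u w : Space N → ℝ) : ℝ :=
  ∫ z in S.U ×ˢ S.U, |u z.1 - u z.2| ^ (r - 2) * (u z.1 - u z.2) * (w z.1 - w z.2)
    / ‖z.1 - z.2‖ ^ ((N : ℝ) + S.s * r)

/-- `(u, v)` is a weak solution on `[0, T)`, `0 < T ≤ ∞`, with initial data `(u₀, v₀)`:
locally in time `u ∈ L^∞(W₀^{s,p}(U))`, `v ∈ L^∞(W₀^{s,q}(U))` with time derivatives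
`u', v' ∈ L²(L²(U))`; the equations hold, for almost every time, against all test functions;
and the energy inequality holds. -/
def IsWeakSolution (S : System N) (u₀ v₀ : L2 S.U) (T : ℝ≥0∞) (u v : ℝ → L2 S.U) : Prop :=
  0 < T ∧
  (∀ t : ℝ, 0 ≤ t → ENNReal.ofReal t < T → (u t, v t) ∈ S.phaseSpace) ∧
  (∀ T' : ℝ, ENNReal.ofReal T' < T → ∃ M : ℝ, ∀ t ∈ Icc 0 T',
    normW0 S.U S.s S.p (u t) ≤ M ∧ normW0 S.U S.s S.q (v t) ≤ M) ∧
  ∃ u' v' : ℝ → L2 S.U,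
    (∀ T' : ℝ, ENNReal.ofReal T' < T →
      MemLp u' 2 (volume.restrict (Ioc 0 T')) ∧ MemLp v' 2 (volume.restrict (Ioc 0 T'))) ∧
    (∀ t : ℝ, 0 ≤ t → ENNReal.ofReal t < T →
      u t = u₀ + ∫ τ in (0 : ℝ)..t, u' τ ∧ v t = v₀ + ∫ τ in (0 : ℝ)..t, v' τ) ∧
    (∀ᵐ t : ℝ, 0 < t → ENNReal.ofReal t < T →
      (∀ w : L2 S.U, MemW0 S.U S.s S.p w →
        inner ℝ (u' t) w + S.K (S.bracket S.p (u t)) * S.fracLaplacePairing S.p (u t) w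
          = ∫ x in S.U, |v t x| ^ S.σ * |u t x| ^ (S.σ - 2) * u t x
              * Real.log |u t x * v t x| * w x) ∧
      (∀ w : L2 S.U, MemW0 S.U S.s S.q w →
        inner ℝ (v' t) w + S.K (S.bracket S.q (v t)) * S.fracLaplacePairing S.q (v t) w
          = ∫ x in S.U, |u t x| ^ S.σ * |v t x| ^ (S.σ - 2) * v t x
              * Real.log |u t x * v t x| * w x)) ∧
    (∀ t : ℝ, 0 ≤ t → ENNReal.ofReal t < T →
      (∫ τ in (0 : ℝ)..t, (‖u' τ‖ ^ 2 + ‖v' τ‖ ^ 2)) + S.energy (u t) (v t)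
        ≤ S.energy u₀ v₀)

/-- The maximal existence time: the supremum of all `T ∈ (0, ∞]` such that there is a weak
solution on `[0, T)` with initial data `(u₀, v₀)`. In particular it bounds the lifespan of every
such weak solution. -/
def Tmax (S : System N) (u₀ v₀ : L2 S.U) : ℝ≥0∞ :=
  sSup {T | ∃ u v : ℝ → L2 S.U, S.IsWeakSolution u₀ v₀ T u v}

end System

end FracKirchhoff

end

/-! The proof is Levine's concavity method inside a potential well. Put `y = ‖u‖² + ‖v‖²`. Testing
the two equations with `u` and `v` gives `y' = -2ψ`, so blow-up follows once `-ψ` is large enough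
compared with the dissipation `Q(t) = ∫₀ᵗ (‖u'‖² + ‖v'‖²)`.

The well supplies this. A pair with `ψ < 0` can be multiplied by some `l ∈ (0, 1]` to reach the
Nehari manifold, which bounds the depth `d` from above by the Kirchhoff and power terms of the pair
itself (`System.depth_le`). Comparing with a lower bound for the energy, where H1 and H2 control the
primitive of `K`, gives `σ d_* ≤ σ φ - ψ` (`System.mul_depthStar_le`). With the energy inequality
this becomes `-ψ(t) ≥ σ (d_* - φ(0) + Q(t))` at every time where `ψ(t) < 0`. So `-ψ` cannot take
values strictly between `0` and `σ (d_* - φ(0))`. As `-ψ` is the derivative of `y / 2`, Darboux's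
theorem forbids a jump across this gap, and `ψ` stays negative. An auxiliary function `F` built from
`∫ y` then satisfies `F F'' ≥ (σ/2) F'²`, so `F^(1 - σ/2)` is concave, which bounds the length of
the time interval (`length_le_of_concavity`).

The delicate point is that Darboux needs `y' = -2ψ` at every time, whereas the equations hold almost
everywhere and the Gagliardo terms need not be continuous in time. Lower semicontinuity bounds the
seminorm from below. Testing with `u(t₀) - u(τ)` and using convexity bounds it from above, up to a
multiple of `‖u'(τ)‖ ‖u(τ) - u(t₀)‖`; the integral of that error over `[t₀, t]` is `o(|t - t₀|)` by
Cauchy–Schwarz (`System.hasDerivWithinAt_half_norm_sq`). The logarithmic integrals are continuous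
along the trajectory by Vitali's theorem, with uniform integrability from a subcritical fractional
Sobolev bound (`boundedInLp_of_lt_criticalExponent`). -/

/-! ### Hilbert-space curves with square-integrable derivative -/

section HilbertCurves

open Filter Topology

variable {H : Type*} [NormedAddCommGroup H]

theorem isFiniteMeasure_restrict_uIoc (a b : ℝ) :
    IsFiniteMeasure (volume.restrict (uIoc a b)) :=
  ⟨by simp [Real.volume_uIoc]⟩

theorem sq_integral_norm_uIoc_le {g : ℝ → H} {a b : ℝ}
    (hg : MemLp g 2 (volume.restrict (uIoc a b))) :
    (∫ τ in uIoc a b, ‖g τ‖) ^ 2 ≤ |b - a| * ∫ τ in uIoc a b, ‖g τ‖ ^ 2 := by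
  have := isFiniteMeasure_restrict_uIoc a b
  have h := integral_mul_le_Lp_mul_Lq_of_nonneg (μ := volume.restrict (uIoc a b))
    (p := 2) (q := 2) (f := fun _ => (1 : ℝ)) (g := fun τ => ‖g τ‖)
    Real.HolderConjugate.two_two (ae_of_all _ fun _ => zero_le_one)
    (ae_of_all _ fun _ => norm_nonneg _) (memLp_const _) (by simpa using hg.norm)
  have hnn : 0 ≤ ∫ τ in uIoc a b, ‖g τ‖ := integral_nonneg fun _ => norm_nonneg _
  have hnn2 : 0 ≤ ∫ τ in uIoc a b, ‖g τ‖ ^ 2 := integral_nonneg fun _ => by positivity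
  have hv : ∫ _ in uIoc a b, (1 : ℝ) = |b - a| := by
    simp [Measure.real, Real.volume_uIoc]
  simp only [one_mul, Real.rpow_two, one_pow, hv, ← Real.sqrt_eq_rpow] at h
  calc _ ≤ (√|b - a| * √(∫ τ in uIoc a b, ‖g τ‖ ^ 2)) ^ 2 := by gcongr
    _ = _ := by rw [mul_pow, Real.sq_sqrt (abs_nonneg _), Real.sq_sqrt hnn2]

theorem tendsto_integral_uIoc_norm_sq {g : ℝ → H} {T t₀ : ℝ}
    (hg : MemLp g 2 (volume.restrict (Ioc 0 T))) (ht₀ : t₀ ∈ Icc 0 T) :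
    Tendsto (fun t => ∫ τ in uIoc t₀ t, ‖g τ‖ ^ 2) (𝓝[Icc 0 T] t₀) (𝓝 0) := by
  have hT : (0 : ℝ) ≤ T := ht₀.1.trans ht₀.2
  have hI : IntervalIntegrable (fun τ => ‖g τ‖ ^ 2) volume 0 T :=
    (intervalIntegrable_iff_integrableOn_Ioc_of_le hT).2 (by
      exact hg.integrable_norm_pow two_ne_zero)
  have hc := intervalIntegral.continuousOn_primitive_interval' hI
    (a := t₀) (by rwa [uIcc_of_le hT])
  rw [uIcc_of_le hT] at hc
  have h := (hc t₀ ht₀).tendsto.abs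
  simp only [intervalIntegral.integral_same, abs_zero] at h
  refine h.congr fun t => ?_
  rw [intervalIntegral.abs_intervalIntegral_eq, abs_of_nonneg]
  exact integral_nonneg fun _ => by positivity

variable [InnerProductSpace ℝ H]

theorem sub_eq_integral_of_primitive {u g : ℝ → H} {u₀ : H} {T : ℝ}
    (hg : MemLp g 2 (volume.restrict (Ioc 0 T)))
    (hu : ∀ t ∈ Icc 0 T, u t = u₀ + ∫ τ in (0 : ℝ)..t, g τ)
    {a b : ℝ} (ha : a ∈ Icc 0 T) (hb : b ∈ Icc 0 T) :
    IntervalIntegrable g volume a b ∧ u b - u a = ∫ τ in a..b, g τ := by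
  have hint : IntegrableOn g (Ioc 0 T) := hg.integrable one_le_two
  have hT : (0 : ℝ) ≤ T := ha.1.trans ha.2
  have hI : IntervalIntegrable g volume 0 T :=
    (intervalIntegrable_iff_integrableOn_Ioc_of_le hT).2 hint
  have h0a : IntervalIntegrable g volume 0 a := hI.mono_set (by
    rw [uIcc_of_le hT, uIcc_of_le ha.1]; exact Icc_subset_Icc_right ha.2)
  have h0b : IntervalIntegrable g volume 0 b := hI.mono_set (by
    rw [uIcc_of_le hT, uIcc_of_le hb.1]; exact Icc_subset_Icc_right hb.2)
  refine ⟨h0a.symm.trans h0b, ?_⟩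
  rw [hu a ha, hu b hb, ← intervalIntegral.integral_interval_sub_left h0b h0a]
  abel

theorem uIoc_subset_Ioc_of_mem {T a b : ℝ} (ha : a ∈ Icc 0 T) (hb : b ∈ Icc 0 T) :
    uIoc a b ⊆ Ioc 0 T := by
  intro x hx
  rw [uIoc, mem_Ioc] at hx
  exact ⟨lt_of_le_of_lt (le_min ha.1 hb.1) hx.1, hx.2.trans (max_le ha.2 hb.2)⟩

theorem norm_sub_le_integral_norm {u g : ℝ → H} {u₀ : H} {T : ℝ}
    (hg : MemLp g 2 (volume.restrict (Ioc 0 T)))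
    (hu : ∀ t ∈ Icc 0 T, u t = u₀ + ∫ τ in (0 : ℝ)..t, g τ)
    {a b : ℝ} (ha : a ∈ Icc 0 T) (hb : b ∈ Icc 0 T) :
    ‖u b - u a‖ ≤ ∫ τ in uIoc a b, ‖g τ‖ := by
  rw [(sub_eq_integral_of_primitive hg hu ha hb).2]
  exact intervalIntegral.norm_integral_le_integral_norm_uIoc

theorem tendsto_of_primitive {u g : ℝ → H} {u₀ : H} {T t₀ : ℝ}
    (hg : MemLp g 2 (volume.restrict (Ioc 0 T)))
    (hu : ∀ t ∈ Icc 0 T, u t = u₀ + ∫ τ in (0 : ℝ)..t, g τ) (ht₀ : t₀ ∈ Icc 0 T) :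
    Tendsto u (𝓝[Icc 0 T] t₀) (𝓝 (u t₀)) := by
  have hT : (0 : ℝ) ≤ T := ht₀.1.trans ht₀.2
  have hI : IntervalIntegrable g volume 0 T :=
    (intervalIntegrable_iff_integrableOn_Ioc_of_le hT).2 (hg.integrable one_le_two)
  have hc := intervalIntegral.continuousOn_primitive_interval' hI (a := 0) left_mem_uIcc
  rw [uIcc_of_le hT] at hc
  exact (((continuousOn_const (c := u₀)).add hc).congr hu) t₀ ht₀

/-- The a.e. derivative `⟨g, u⟩` need not converge to `L` at `t₀`: an error proportional to `‖g τ‖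
‖u τ - u t₀‖` is allowed. Between `t₀` and `t` its integral is at most `C m²` with `m = ∫ ‖g‖`, and
`m² ≤ |t - t₀| ∫ ‖g‖² = o(|t - t₀|)`. -/
theorem hasDerivWithinAt_half_norm_sq [CompleteSpace H] {u g : ℝ → H} {u₀ : H} {T L t₀ : ℝ}
    (hg : MemLp g 2 (volume.restrict (Ioc 0 T)))
    (hu : ∀ t ∈ Icc 0 T, u t = u₀ + ∫ τ in (0 : ℝ)..t, g τ) (ht₀ : t₀ ∈ Icc 0 T)
    (h : ∀ ε > 0, ∃ C, ∃ δ > 0, ∀ᵐ τ : ℝ, τ ∈ Ioc 0 T → |τ - t₀| < δ →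
      |inner ℝ (g τ) (u τ) - L| ≤ ε + C * (‖g τ‖ * ‖u τ - u t₀‖)) :
    HasDerivWithinAt (fun t => ‖u t‖ ^ 2 / 2) L (Icc 0 T) t₀ := by
  rw [hasDerivWithinAt_iff_isLittleO, Asymptotics.isLittleO_iff]
  intro c hc
  obtain ⟨C, δ, hδ, hae⟩ := h (c / 2) (by positivity)
  have hC' : (0 : ℝ) < |C| + 2 := by positivity
  -- The factor `|C| + 2` covers the total coefficient of `m²` below: `|C|` from the hypothesis, `1`
  -- from replacing `u τ` by `u t₀`, and `1/2` from the quadratic remainder.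
  have hsmall := (tendsto_integral_uIoc_norm_sq hg ht₀).eventually
    (gt_mem_nhds (show 0 < c / 2 / (|C| + 2) by positivity))
  have hnear : ∀ᶠ t in 𝓝[Icc 0 T] t₀, |t - t₀| < δ :=
    nhdsWithin_le_nhds (Metric.ball_mem_nhds t₀ hδ)
  filter_upwards [hsmall, hnear, self_mem_nhdsWithin] with t hQ htδ ht
  obtain ⟨hgi, hsub⟩ := sub_eq_integral_of_primitive hg hu ht₀ ht
  have := isFiniteMeasure_restrict_uIoc t₀ t
  set m := ∫ τ in uIoc t₀ t, ‖g τ‖ with hm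
  have hgS : MemLp g 2 (volume.restrict (uIoc t₀ t)) :=
    hg.mono_measure (Measure.restrict_mono (uIoc_subset_Ioc_of_mem ht₀ ht) le_rfl)
  have hmsq := sq_integral_norm_uIoc_le hgS
  have hm0 : 0 ≤ m := integral_nonneg fun _ => norm_nonneg _
  have hlin : inner ℝ (u t - u t₀) (u t₀) - (t - t₀) * L
      = ∫ τ in t₀..t, (inner ℝ (g τ) (u t₀) - L) := by
    have hii : IntervalIntegrable (fun τ => inner ℝ (g τ) (u t₀)) volume t₀ t := by
      rw [intervalIntegrable_iff] at hgi ⊢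
      exact hgi.inner_const _
    have := (innerSL ℝ (u t₀)).intervalIntegral_comp_comm hgi
    simp only [innerSL_apply_apply] at this
    rw [intervalIntegral.integral_sub hii (by simp), intervalIntegral.integral_const, hsub,
      real_inner_comm, ← this, smul_eq_mul]
    simp only [real_inner_comm]
  have hIb : |∫ τ in t₀..t, (inner ℝ (g τ) (u t₀) - L)|
      ≤ c / 2 * |t - t₀| + (|C| + 1) * m ^ 2 := by
    have h1 : ∀ᵐ τ ∂volume.restrict (uIoc t₀ t), ‖inner ℝ (g τ) (u t₀) - L‖
        ≤ c / 2 + (|C| + 1) * m * ‖g τ‖ := by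
      filter_upwards [ae_restrict_of_ae hae, ae_restrict_mem measurableSet_uIoc] with τ hτ hτS
      have hτT := uIoc_subset_Ioc_of_mem ht₀ ht hτS
      have hτI : τ ∈ Icc 0 T := ⟨hτT.1.le, hτT.2⟩
      have hτuI : τ ∈ uIcc t₀ t := uIoc_subset_uIcc hτS
      have hd : |τ - t₀| < δ := (abs_sub_left_of_mem_uIcc hτuI).trans_lt htδ
      have hb := hτ hτT hd
      have hum : ‖u τ - u t₀‖ ≤ m := (norm_sub_le_integral_norm hg hu ht₀ hτI).trans
        (setIntegral_mono_set (hgS.integrable one_le_two).norm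
          (ae_of_all _ fun _ => norm_nonneg _)
          (uIoc_subset_uIoc_of_uIcc_subset_uIcc (uIcc_subset_uIcc left_mem_uIcc hτuI)
            ).eventuallyLE)
      have hsplit : inner ℝ (g τ) (u t₀) - L
          = (inner ℝ (g τ) (u τ) - L) - inner ℝ (g τ) (u τ - u t₀) := by
        rw [inner_sub_right]; ring
      rw [hsplit, Real.norm_eq_abs]
      have hcs := abs_real_inner_le_norm (g τ) (u τ - u t₀)
      have hgu : ‖g τ‖ * ‖u τ - u t₀‖ ≤ ‖g τ‖ * m := by gcongr
      have hCC : C * (‖g τ‖ * ‖u τ - u t₀‖) ≤ |C| * (‖g τ‖ * m) :=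
        mul_le_mul (le_abs_self C) hgu (by positivity) (abs_nonneg C)
      calc _ ≤ |inner ℝ (g τ) (u τ) - L| + |inner ℝ (g τ) (u τ - u t₀)| := abs_sub _ _
        _ ≤ (c / 2 + |C| * (‖g τ‖ * m)) + ‖g τ‖ * m := by linarith
        _ = _ := by ring
    have hi2 : IntegrableOn (fun τ => (|C| + 1) * m * ‖g τ‖) (uIoc t₀ t) :=
      (hgS.integrable one_le_two).norm.const_mul _
    have hi1 : IntegrableOn (fun _ : ℝ => c / 2) (uIoc t₀ t) := by
      simp [uIoc]
    calc _ ≤ ∫ τ in uIoc t₀ t, ‖inner ℝ (g τ) (u t₀) - L‖ :=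
          intervalIntegral.norm_integral_le_integral_norm_uIoc
      _ ≤ ∫ τ in uIoc t₀ t, (c / 2 + (|C| + 1) * m * ‖g τ‖) :=
          integral_mono_of_nonneg (ae_of_all _ fun _ => norm_nonneg _) (hi1.add hi2) h1
      _ = c / 2 * |t - t₀| + (|C| + 1) * m ^ 2 := by
          rw [integral_add hi1 hi2, integral_const_mul]
          simp [Measure.real, Real.volume_uIoc, ← hm]
          ring
  have hum : ‖u t - u t₀‖ ^ 2 ≤ m ^ 2 := by
    have := norm_sub_le_integral_norm hg hu ht₀ ht
    gcongr
  have hexp : ‖u t‖ ^ 2 / 2 - ‖u t₀‖ ^ 2 / 2 - (t - t₀) • L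
      = (inner ℝ (u t - u t₀) (u t₀) - (t - t₀) * L) + ‖u t - u t₀‖ ^ 2 / 2 := by
    have h1 := norm_add_sq_real (u t - u t₀) (u t₀)
    rw [sub_add_cancel] at h1
    rw [h1, smul_eq_mul]; ring
  rw [hexp, hlin, Real.norm_eq_abs, Real.norm_eq_abs]
  have hQ' : (|C| + 2) * m ^ 2 ≤ |t - t₀| * (c / 2) := by
    calc (|C| + 2) * m ^ 2 ≤ (|C| + 2) * (|t - t₀| * ∫ τ in uIoc t₀ t, ‖g τ‖ ^ 2) := by gcongr
      _ ≤ (|C| + 2) * (|t - t₀| * (c / 2 / (|C| + 2))) := by gcongr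
      _ = _ := by field_simp
  calc _ ≤ |∫ τ in t₀..t, (inner ℝ (g τ) (u t₀) - L)| + |‖u t - u t₀‖ ^ 2 / 2| :=
        abs_add_le _ _
    _ ≤ (c / 2 * |t - t₀| + (|C| + 1) * m ^ 2) + m ^ 2 / 2 := by
        rw [abs_of_nonneg (show 0 ≤ ‖u t - u t₀‖ ^ 2 / 2 by positivity)]; linarith
    _ ≤ c * |t - t₀| := by nlinarith [sq_nonneg m]

/-- Integrate `‖x u - g‖² ≥ 0`; the cross term is a total derivative. This is Cauchy–Schwarz kept as
a quadratic form in `x`, so that several such forms can be added before taking a discriminant. -/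
theorem quadratic_form_nonneg_of_primitive [CompleteSpace H] {u g : ℝ → H} {u₀ : H} {T : ℝ}
    {P : ℝ → ℝ} (hg : MemLp g 2 (volume.restrict (Ioc 0 T)))
    (hu : ∀ t ∈ Icc 0 T, u t = u₀ + ∫ τ in (0 : ℝ)..t, g τ)
    (hd : ∀ t ∈ Icc 0 T, HasDerivWithinAt (fun t => ‖u t‖ ^ 2 / 2) (P t) (Icc 0 T) t)
    (hP : ∀ᵐ τ : ℝ, τ ∈ Ioc 0 T → inner ℝ (g τ) (u τ) = P τ) {t : ℝ} (ht : t ∈ Icc 0 T) (x : ℝ) :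
    0 ≤ x ^ 2 * (∫ τ in (0 : ℝ)..t, ‖u τ‖ ^ 2) - x * (‖u t‖ ^ 2 - ‖u 0‖ ^ 2)
      + ∫ τ in (0 : ℝ)..t, ‖g τ‖ ^ 2 := by
  have h0T : (0 : ℝ) ∈ Icc 0 T := ⟨le_rfl, ht.1.trans ht.2⟩
  have hsub : Ioc 0 t ⊆ Ioc 0 T := Ioc_subset_Ioc_right ht.2
  have hgS : MemLp g 2 (volume.restrict (Ioc 0 t)) :=
    hg.mono_measure (Measure.restrict_mono hsub le_rfl)
  have hucont : ContinuousOn u (Icc 0 T) := fun t₀ ht₀ => tendsto_of_primitive hg hu ht₀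
  have huS : MemLp u 2 (volume.restrict (Ioc 0 t)) := by
    have hc : ContinuousOn u (Icc 0 t) := hucont.mono (Icc_subset_Icc_right ht.2)
    obtain ⟨M, hM⟩ := (isCompact_Icc.image_of_continuousOn hc).isBounded.exists_norm_le
    refine MemLp.of_bound ((hc.mono Ioc_subset_Icc_self).aestronglyMeasurable measurableSet_Ioc)
      M ?_
    filter_upwards [ae_restrict_mem measurableSet_Ioc] with τ hτ
    exact hM _ (mem_image_of_mem _ (Ioc_subset_Icc_self hτ))
  have hu2 : IntervalIntegrable (fun τ => ‖u τ‖ ^ 2) volume 0 t :=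
    (intervalIntegrable_iff_integrableOn_Ioc_of_le ht.1).2 (huS.integrable_norm_pow two_ne_zero)
  have hg2 : IntervalIntegrable (fun τ => ‖g τ‖ ^ 2) volume 0 t :=
    (intervalIntegrable_iff_integrableOn_Ioc_of_le ht.1).2 (hgS.integrable_norm_pow two_ne_zero)
  have hgu : IntervalIntegrable (fun τ => inner ℝ (g τ) (u τ)) volume 0 t := by
    refine (intervalIntegrable_iff_integrableOn_Ioc_of_le ht.1).2 ?_
    refine Integrable.mono' (g := fun τ => ‖u τ‖ ^ 2 + ‖g τ‖ ^ 2)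
      ((huS.integrable_norm_pow two_ne_zero).add (hgS.integrable_norm_pow two_ne_zero))
      (hgS.1.inner huS.1) (ae_of_all _ fun τ => ?_)
    have := norm_inner_le_norm (𝕜 := ℝ) (g τ) (u τ)
    nlinarith [sq_nonneg (‖u τ‖ - ‖g τ‖), norm_nonneg (u τ), norm_nonneg (g τ),
      mul_nonneg (norm_nonneg (u τ)) (norm_nonneg (g τ))]
  have hae : ∀ᵐ τ ∂volume.restrict (Ioc 0 t), inner ℝ (g τ) (u τ) = P τ := by
    filter_upwards [ae_restrict_of_ae hP, ae_restrict_mem measurableSet_Ioc] with τ h1 h2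
    exact h1 (hsub h2)
  have hPint : IntervalIntegrable P volume 0 t := by
    rw [intervalIntegrable_iff_integrableOn_Ioc_of_le ht.1] at hgu ⊢
    exact hgu.congr hae
  have hftc : ∫ τ in (0 : ℝ)..t, inner ℝ (g τ) (u τ) = ‖u t‖ ^ 2 / 2 - ‖u 0‖ ^ 2 / 2 := by
    rw [← intervalIntegral.integral_eq_sub_of_hasDerivAt_of_le (f := fun t => ‖u t‖ ^ 2 / 2)
      ht.1 (fun s hs => ?_) (fun s hs => ?_) hPint]
    · rw [intervalIntegral.integral_of_le ht.1, intervalIntegral.integral_of_le ht.1]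
      exact integral_congr_ae hae
    · exact (hd s ⟨hs.1, hs.2.trans ht.2⟩).continuousWithinAt.mono (Icc_subset_Icc_right ht.2)
    · exact (hd s ⟨hs.1.le, hs.2.le.trans ht.2⟩).hasDerivAt
        (Icc_mem_nhds hs.1 (hs.2.trans_le ht.2))
  have hnn : 0 ≤ ∫ τ in (0 : ℝ)..t,
      (x ^ 2 * ‖u τ‖ ^ 2 - 2 * x * inner ℝ (g τ) (u τ) + ‖g τ‖ ^ 2) := by
    refine intervalIntegral.integral_nonneg ht.1 fun τ _ => ?_
    have h1 := abs_le.1 (abs_real_inner_le_norm (g τ) (u τ))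
    have h2 := norm_sub_sq_real (x • u τ) (g τ)
    rw [norm_smul, real_inner_smul_left, real_inner_comm, mul_pow, Real.norm_eq_abs,
      sq_abs] at h2
    nlinarith [sq_nonneg ‖x • u τ - g τ‖]
  rw [intervalIntegral.integral_add ((hu2.const_mul _).sub (hgu.const_mul _)) hg2,
    intervalIntegral.integral_sub (hu2.const_mul _) (hgu.const_mul _),
    intervalIntegral.integral_const_mul, intervalIntegral.integral_const_mul, hftc] at hnn
  linarith

end HilbertCurves

/-! ### Levine's concavity argument -/

/-- With `D = F'`, the inequality `F D' ≥ (σ/2) D²` says `(F/D)' ≤ -(σ - 2)/2`. Since `F/D` stays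
positive on `[0, T]`, its initial value limits `T`. -/
theorem length_le_of_concavity {y P Q : ℝ → ℝ} {T b σ : ℝ} (hT : 0 < T) (hσ : 2 < σ) (hb : 0 < b)
    (hy0 : 0 < y 0) (hynn : ∀ t, 0 ≤ y t)
    (hy : ∀ t ∈ Icc 0 T, HasDerivWithinAt y (2 * P t) (Icc 0 T) t)
    (hCS : ∀ t ∈ Icc 0 T, ∀ x : ℝ,
      0 ≤ x ^ 2 * (∫ τ in (0 : ℝ)..t, y τ) - x * (y t - y 0) + Q t)
    (hQ : ∀ t ∈ Icc 0 T, 0 ≤ Q t)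
    (hP : ∀ t ∈ Icc 0 T, σ * (Q t + b) ≤ P t + b) :
    T ≤ 4 * y 0 / ((σ - 2) ^ 2 * b) := by
  have hσ2 : 0 < σ - 2 := by linarith
  -- The time shift that minimises the resulting bound on `T`.
  set c := 2 * y 0 / ((σ - 2) * b) with hc
  have hcpos : 0 < c := by positivity
  set F : ℝ → ℝ := fun t => (∫ τ in (0 : ℝ)..t, y τ) + (T - t) * y 0 + b * (t + c) ^ 2 with hF
  set D : ℝ → ℝ := fun t => y t - y 0 + 2 * b * (t + c) with hD
  have hycont : ContinuousOn y (Icc 0 T) := fun t ht => (hy t ht).continuousWithinAt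
  have hyint : IntervalIntegrable y volume 0 T := hycont.intervalIntegrable_of_Icc hT.le
  have hDder : ∀ t ∈ Icc 0 T, HasDerivWithinAt D (2 * P t + 2 * b) (Icc 0 T) t := by
    intro t ht
    have h1 := ((hy t ht).sub_const (y 0)).add
      ((((hasDerivWithinAt_id t (Icc 0 T)).add_const c)).const_mul (2 * b))
    rw [mul_one] at h1
    exact h1
  have hFcont : ContinuousOn F (Icc 0 T) := by
    have h1 := intervalIntegral.continuousOn_primitive_interval' hyint (a := 0) left_mem_uIcc
    rw [uIcc_of_le hT.le] at h1
    exact (h1.add (by fun_prop)).add (by fun_prop)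
  have hFder : ∀ t ∈ Ioo 0 T, HasDerivAt F (D t) t := by
    intro t ht
    have h1 : HasDerivAt (fun t => ∫ τ in (0 : ℝ)..t, y τ) (y t) t := by
      refine intervalIntegral.integral_hasDerivAt_right ?_ ?_ ?_
      · exact hyint.mono_set (by
          rw [uIcc_of_le hT.le, uIcc_of_le ht.1.le]; exact Icc_subset_Icc_right ht.2.le)
      · exact ⟨Icc 0 T, Icc_mem_nhds ht.1 ht.2, hycont.aestronglyMeasurable measurableSet_Icc⟩
      · exact (hycont t (Ioo_subset_Icc_self ht)).continuousAt (Icc_mem_nhds ht.1 ht.2)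
    have h2 := (h1.add ((((hasDerivAt_id t).const_sub T)).mul_const (y 0))).add
      ((((hasDerivAt_id t).add_const c).pow 2).const_mul b)
    refine h2.congr_deriv ?_
    simp only [hD, id, Nat.cast_ofNat, Nat.add_one_sub_one, pow_one]; ring
  have hDmono : MonotoneOn D (Icc 0 T) := by
    refine monotoneOn_of_hasDerivWithinAt_nonneg (f' := fun t => 2 * P t + 2 * b)
      (convex_Icc 0 T) (fun t ht => (hDder t ht).continuousWithinAt) (fun t ht => ?_)
      (fun t ht => ?_)
    · exact (hDder t (interior_subset ht)).mono interior_subset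
    · have := hP t (interior_subset ht)
      have := hQ t (interior_subset ht)
      nlinarith
  have hD0 : D 0 = 2 * b * c := by simp [hD]
  have hDpos : ∀ t ∈ Icc 0 T, 0 < D t := fun t ht => by
    have := hDmono ⟨le_rfl, hT.le⟩ ht ht.1
    rw [hD0] at this
    have : 0 < 2 * b * c := by positivity
    linarith
  have hFpos : ∀ t ∈ Icc 0 T, 0 < F t := fun t ht => by
    have h1 : 0 ≤ ∫ τ in (0 : ℝ)..t, y τ :=
      intervalIntegral.integral_nonneg ht.1 fun τ _ => hynn τ
    have h2 : 0 ≤ (T - t) * y 0 := mul_nonneg (by linarith [ht.2]) hy0.le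
    have h3 : 0 < b * (t + c) ^ 2 := by
      have : 0 < t + c := by linarith [ht.1]
      positivity
    simp only [hF]; linarith
  have hkey : ∀ t ∈ Icc 0 T, σ / 2 * D t ^ 2 ≤ F t * (2 * P t + 2 * b) := by
    intro t ht
    have hFp := hFpos t ht
    -- The sum of three nonnegative forms: the hypothesis, `x² (T - t) y(0)` and `b (x (t + c) -
    -- 1)²`. Its value at the minimiser `x = D/(2F)` gives `D² ≤ 4 F (Q + b)`.
    have h1 : ∀ x : ℝ, 0 ≤ x ^ 2 * F t - x * D t + (Q t + b) := by
      intro x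
      have h2 := hCS t ht x
      have h3 : 0 ≤ x ^ 2 * ((T - t) * y 0) :=
        mul_nonneg (sq_nonneg x) (mul_nonneg (by linarith [ht.2]) hy0.le)
      have h4 : 0 ≤ b * (x * (t + c) - 1) ^ 2 := by positivity
      simp only [hF, hD]; nlinarith
    have h2 : D t ^ 2 ≤ 4 * F t * (Q t + b) := by
      have h3 := h1 (D t / (2 * F t))
      have h4 : (D t / (2 * F t)) ^ 2 * F t - D t / (2 * F t) * D t + (Q t + b)
          = (4 * F t * (Q t + b) - D t ^ 2) / (4 * F t) := by field_simp; ring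
      rw [h4] at h3
      have := (le_div_iff₀ (show 0 < 4 * F t by positivity)).1 h3
      linarith
    have h5 := mul_le_mul_of_nonneg_left (hP t ht) hFp.le
    nlinarith
  have hanti : AntitoneOn (fun t => F t / D t + (σ - 2) / 2 * t) (Icc 0 T) := by
    refine antitoneOn_of_hasDerivWithinAt_nonpos
      (f' := fun t => (D t * D t - F t * (2 * P t + 2 * b)) / D t ^ 2 + (σ - 2) / 2)
      (convex_Icc 0 T) ?_ (fun t ht => ?_) (fun t ht => ?_)
    · refine (hFcont.div (fun t ht => (hDder t ht).continuousWithinAt)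
        fun t ht => (hDpos t ht).ne').add (by fun_prop)
    · rw [interior_Icc] at ht
      have htI := Ioo_subset_Icc_self ht
      have h1 := (hFder t ht).div ((hDder t htI).hasDerivAt (Icc_mem_nhds ht.1 ht.2))
        (hDpos t htI).ne'
      have h2 := (h1.add ((hasDerivAt_id t).const_mul ((σ - 2) / 2)))
      rw [mul_one] at h2
      rw [interior_Icc]
      exact h2.hasDerivWithinAt
    · have htI := interior_subset ht
      have h1 := hkey t htI
      have h2 := hDpos t htI
      have h3 : (D t * D t - F t * (2 * P t + 2 * b)) / D t ^ 2 ≤ -((σ - 2) / 2) := by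
        rw [div_le_iff₀ (by positivity)]; nlinarith
      linarith
  have hle := hanti ⟨le_rfl, hT.le⟩ ⟨hT.le, le_rfl⟩ hT.le
  have hpos := div_pos (hFpos T ⟨hT.le, le_rfl⟩) (hDpos T ⟨hT.le, le_rfl⟩)
  have hF0 : F 0 = T * y 0 + b * c ^ 2 := by simp [hF]
  simp only [mul_zero, add_zero, hF0, hD0] at hle
  have h0 : (T * y 0 + b * c ^ 2) / (2 * b * c)
      = T * (σ - 2) / 4 + y 0 / ((σ - 2) * b) := by
    rw [hc]; field_simp; ring
  rw [h0] at hle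
  have h1 : T * (σ - 2) / 4 ≤ y 0 / ((σ - 2) * b) := by nlinarith
  rw [le_div_iff₀ (by positivity)] at h1 ⊢
  nlinarith

/-! ### Subcritical fractional Sobolev embedding -/

namespace FracKirchhoff

section Embedding

variable {N : ℕ} {s p : ℝ} {w : Space N → ℝ}

theorem gagliardoKernel_nonneg (z : Space N × Space N) : 0 ≤ gagliardoKernel s p w z :=
  div_nonneg (Real.rpow_nonneg (abs_nonneg _) _) (Real.rpow_nonneg (norm_nonneg _) _)

theorem rpow_abs_sub_le_mul_gagliardoKernel (hs : 0 < s) (hp : 0 < p) {ρ : ℝ} {x y : Space N}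
    (hy : y ∈ Metric.ball x ρ) :
    |w x - w y| ^ p ≤ ρ ^ ((N : ℝ) + s * p) * gagliardoKernel s p w (x, y) := by
  have hyx : ‖x - y‖ < ρ := by rwa [Metric.mem_ball, dist_comm, dist_eq_norm] at hy
  have hρ : 0 < ρ := (norm_nonneg _).trans_lt hyx
  rcases eq_or_ne x y with rfl | hxy
  · rw [sub_self, abs_zero, Real.zero_rpow hp.ne']
    exact mul_nonneg (Real.rpow_nonneg hρ.le _) (gagliardoKernel_nonneg _)
  · have hpos : 0 < ‖x - y‖ := norm_pos_iff.2 (sub_ne_zero.2 hxy)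
    have hexp : 0 ≤ (N : ℝ) + s * p := by positivity
    rw [gagliardoKernel, mul_div_assoc', le_div_iff₀ (Real.rpow_pos_of_pos hpos _), mul_comm]
    gcongr

/-- One of `|a - b|`, `|b|` is at least `l/2`. This merges into one inequality the points where `w`
is large and those where its increment is large. -/
theorem one_le_rpow_add_rpow {a b l p m : ℝ} (hl : 0 < l) (ha : |a| = l) (hp : 0 < p)
    (hm : 0 < m) : 1 ≤ (2 / l) ^ p * |a - b| ^ p + (2 / l) ^ m * |b| ^ m := by
  have h2l : 0 < 2 / l := by positivity
  rw [← Real.mul_rpow h2l.le (abs_nonneg _), ← Real.mul_rpow h2l.le (abs_nonneg _)]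
  have htri : l ≤ |a - b| + |b| := by
    rw [← ha]; simpa using abs_add_le (a - b) b
  rcases le_total (l / 2) |b| with h | h
  · have h1 : 1 ≤ 2 / l * |b| := by
      calc (1 : ℝ) = 2 / l * (l / 2) := by field_simp
        _ ≤ _ := by gcongr
    have := Real.one_le_rpow h1 hm.le
    have : 0 ≤ (2 / l * |a - b|) ^ p := by positivity
    linarith
  · have h1 : 1 ≤ 2 / l * |a - b| := by
      calc (1 : ℝ) = 2 / l * (l / 2) := by field_simp
        _ ≤ _ := by gcongr; linarith
    have := Real.one_le_rpow h1 hp.le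
    have : 0 ≤ (2 / l * |b|) ^ m := by positivity
    linarith

theorem measureReal_ball_eq (x : Space N) {ρ : ℝ} (hρ : 0 < ρ) :
    volume.real (Metric.ball x ρ) = ρ ^ (N : ℝ) * volume.real (Metric.ball (0 : Space N) 1) := by
  rw [Measure.real, Measure.addHaar_ball_of_pos _ _ hρ, ENNReal.toReal_mul,
    ENNReal.toReal_ofReal (by positivity), finrank_euclideanSpace_fin, Real.rpow_natCast]
  rfl

/-- Pointwise form of the gain of integrability in the fractional Sobolev inequality. -/
theorem rpow_abs_le_mul_integral_gagliardoKernel (hN : 0 < N) (hs : 0 < s) (hp : 0 < p)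
    {m M : ℝ} (hm : 0 < m) (hM : 0 < M) (hw : Integrable fun y => |w y| ^ m)
    (hwM : ∫ y, |w y| ^ m ≤ M) {x : Space N}
    (hx : Integrable fun y => gagliardoKernel s p w (x, y)) :
    |w x| ^ (p + s * p / N * m) ≤
      2 ^ (p + 1) / volume.real (Metric.ball (0 : Space N) 1)
        * (2 * 2 ^ m * M / volume.real (Metric.ball (0 : Space N) 1)) ^ (s * p / N)
        * ∫ y, gagliardoKernel s p w (x, y) := by
  set ω := volume.real (Metric.ball (0 : Space N) 1) with hω
  have hωpos : 0 < ω := ENNReal.toReal_pos (Metric.measure_ball_pos _ _ one_pos).ne'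
    measure_ball_lt_top.ne
  have hN' : (0 : ℝ) < N := by exact_mod_cast hN
  have hgnn : 0 ≤ ∫ y, gagliardoKernel s p w (x, y) :=
    integral_nonneg fun _ => gagliardoKernel_nonneg _
  have hexp : 0 < p + s * p / N * m := by positivity
  rcases eq_or_lt_of_le (abs_nonneg (w x)) with h0 | hl
  · rw [← h0, Real.zero_rpow hexp.ne']; positivity
  set l := |w x| with hldef
  set g := ∫ y, gagliardoKernel s p w (x, y) with hg
  set R := 2 * 2 ^ m * M / ω with hR
  have hRpos : 0 < R := by positivity
  -- The radius at which Chebyshev's bound `(2/l)^m M` for the set `|w| ≥ l/2` is exactly half the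
  -- volume of the ball. On the other half the increment from `x` is at least `l/2`, so the kernel
  -- integral is large.
  set ρ := (R / l ^ m) ^ (1 / (N : ℝ)) with hρ
  have hρpos : 0 < ρ := by positivity
  have hρN : ρ ^ (N : ℝ) = R / l ^ m := by
    rw [hρ, ← Real.rpow_mul (by positivity), one_div_mul_cancel hN'.ne', Real.rpow_one]
  have hρsp : ρ ^ (s * p) = R ^ (s * p / N) / l ^ (s * p / N * m) := by
    rw [hρ, ← Real.rpow_mul (by positivity), Real.div_rpow hRpos.le (by positivity),
      ← Real.rpow_mul hl.le]
    congr 2 <;> ring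
  have hmain : ω * ρ ^ (N : ℝ) ≤ (2 / l) ^ p * (ρ ^ ((N : ℝ) + s * p) * g) + (2 / l) ^ m * M := by
    have h1 : ∫ _ in Metric.ball x ρ, (1 : ℝ) = ω * ρ ^ (N : ℝ) := by
      simp [measureReal_ball_eq x hρpos, hω, mul_comm]
    rw [← h1]
    have hi : Integrable (fun y => (2 / l) ^ p * (ρ ^ ((N : ℝ) + s * p)
        * gagliardoKernel s p w (x, y)) + (2 / l) ^ m * |w y| ^ m) :=
      ((hx.const_mul _).const_mul _).add (hw.const_mul _)
    calc ∫ _ in Metric.ball x ρ, (1 : ℝ)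
        ≤ ∫ y in Metric.ball x ρ, ((2 / l) ^ p * (ρ ^ ((N : ℝ) + s * p)
          * gagliardoKernel s p w (x, y)) + (2 / l) ^ m * |w y| ^ m) := by
          refine setIntegral_mono_on (by simp [measure_ball_lt_top]) hi.integrableOn
            measurableSet_ball fun y hy => ?_
          have h2 := one_le_rpow_add_rpow (b := w y) hl hldef.symm hp hm
          have h3 := rpow_abs_sub_le_mul_gagliardoKernel (w := w) hs hp hy
          refine h2.trans ?_
          gcongr
      _ ≤ ∫ y, ((2 / l) ^ p * (ρ ^ ((N : ℝ) + s * p)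
          * gagliardoKernel s p w (x, y)) + (2 / l) ^ m * |w y| ^ m) := by
          refine setIntegral_le_integral hi (ae_of_all _ fun y => ?_)
          have := gagliardoKernel_nonneg (s := s) (p := p) (w := w) (x, y)
          positivity
      _ ≤ _ := by
          rw [integral_add ((hx.const_mul _).const_mul _) (hw.const_mul _), integral_const_mul,
            integral_const_mul, integral_const_mul]
          gcongr
  have hhalf : (2 / l) ^ m * M = ω * ρ ^ (N : ℝ) / 2 := by
    rw [hρN, hR, Real.div_rpow zero_le_two hl.le]; field_simp
  rw [hhalf, Real.rpow_add hρpos] at hmain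
  have hρNpos : 0 < ρ ^ (N : ℝ) := by positivity
  have h4 : ω / 2 ≤ (2 / l) ^ p * (ρ ^ (s * p) * g) := by
    have : ρ ^ (N : ℝ) * (ω / 2) ≤ ρ ^ (N : ℝ) * ((2 / l) ^ p * (ρ ^ (s * p) * g)) := by
      linarith
    exact le_of_mul_le_mul_left this hρNpos
  rw [hρsp, Real.div_rpow zero_le_two hl.le] at h4
  rw [Real.rpow_add hl, Real.rpow_add two_pos, Real.rpow_one]
  have h5 : 2 ^ p / l ^ p * (R ^ (s * p / ↑N) / l ^ (s * p / ↑N * m) * g)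
      = (2 ^ p * R ^ (s * p / ↑N) * g) / (l ^ p * l ^ (s * p / ↑N * m)) := by field_simp
  rw [h5, le_div_iff₀ (by positivity)] at h4
  have h6 : 2 ^ p * 2 / ω * R ^ (s * p / ↑N) * g = (2 ^ p * R ^ (s * p / ↑N) * g) / (ω / 2) := by
    field_simp
  rw [h6, le_div_iff₀ (by positivity)]
  linarith

/-- The family `F` is bounded in `L^m`. -/
def BoundedInLp (F : Set (Space N → ℝ)) (m : ℝ) : Prop :=
  ∃ C, ∀ w ∈ F, Integrable (fun x => |w x| ^ m) ∧ ∫ x, |w x| ^ m ≤ C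

/-- The pointwise bound integrated in `x`. The map `m ↦ p + (s p / N) m` has the critical exponent
as its fixed point when `s p < N`, and has no positive fixed point otherwise. -/
theorem BoundedInLp.gain (hN : 0 < N) (hs : 0 < s) (hp : 0 < p) {F : Set (Space N → ℝ)} {m M : ℝ}
    (hm : 0 < m) (hF : ∀ w ∈ F, AEStronglyMeasurable w ∧
      Integrable (gagliardoKernel s p w) ∧ ∫ z, gagliardoKernel s p w z ≤ M)
    (h : BoundedInLp F m) : BoundedInLp F (p + s * p / N * m) := by
  obtain ⟨C, hC⟩ := h
  set A := 2 ^ (p + 1) / volume.real (Metric.ball (0 : Space N) 1)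
        * (2 * 2 ^ m * (|C| + 1) / volume.real (Metric.ball (0 : Space N) 1)) ^ (s * p / N)
  have hA : 0 ≤ A := by positivity
  refine ⟨A * M, fun w hw => ?_⟩
  obtain ⟨hmeas, hker, hkM⟩ := hF w hw
  have hker' : Integrable (gagliardoKernel s p w) (volume.prod volume) := hker
  obtain ⟨hwi, hwC⟩ := hC w hw
  have hae : ∀ᵐ x, |w x| ^ (p + s * p / N * m) ≤ A * ∫ y, gagliardoKernel s p w (x, y) := by
    filter_upwards [hker'.prod_right_ae] with x hx
    exact rpow_abs_le_mul_integral_gagliardoKernel hN hs hp hm (by positivity) hwi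
      (by linarith [le_abs_self C]) hx
  have hint := hker'.integral_prod_left.const_mul A
  have hnn : ∀ x, 0 ≤ |w x| ^ (p + s * p / N * m) := fun x => by positivity
  refine ⟨hint.mono' ?_ ?_, ?_⟩
  · exact (hmeas.norm.aemeasurable.pow_const _).aestronglyMeasurable
  · filter_upwards [hae] with x hx
    rwa [Real.norm_eq_abs, abs_of_nonneg (hnn x)]
  · calc _ ≤ ∫ x, A * ∫ y, gagliardoKernel s p w (x, y) :=
          integral_mono_of_nonneg (ae_of_all _ hnn) hint hae
      _ = A * ∫ z, gagliardoKernel s p w z := by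
          rw [integral_const_mul, ← integral_prod _ hker']; rfl
      _ ≤ A * M := by gcongr

theorem BoundedInLp.mono_exponent {F : Set (Space N → ℝ)} {U : Set (Space N)} {r m : ℝ}
    (hU : MeasurableSet U) (hUfin : volume U ≠ ⊤) (hr : 0 < r) (hrm : r ≤ m)
    (hF : ∀ w ∈ F, AEStronglyMeasurable w ∧ ∀ x ∉ U, w x = 0) (h : BoundedInLp F m) :
    BoundedInLp F r := by
  obtain ⟨C, hC⟩ := h
  refine ⟨volume.real U + C, fun w hw => ?_⟩
  obtain ⟨hwi, hwC⟩ := hC w hw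
  obtain ⟨hmeas, hzero⟩ := hF w hw
  have hUi : Integrable (U.indicator fun _ => (1 : ℝ)) :=
    (integrable_indicator_iff hU).2 (by simp [hUfin.lt_top])
  have hle : ∀ x, |w x| ^ r ≤ U.indicator (fun _ => (1 : ℝ)) x + |w x| ^ m := by
    intro x
    by_cases hx : x ∈ U
    · rw [indicator_of_mem hx]
      rcases le_total |w x| 1 with h1 | h1
      · have := Real.rpow_le_one (abs_nonneg _) h1 hr.le
        have : 0 ≤ |w x| ^ m := by positivity
        linarith
      · have := Real.rpow_le_rpow_of_exponent_le h1 hrm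
        linarith
    · rw [indicator_of_notMem hx, hzero x hx, abs_zero, Real.zero_rpow hr.ne',
        Real.zero_rpow (hr.trans_le hrm).ne', zero_add]
  have hnn : ∀ x, 0 ≤ |w x| ^ r := fun x => by positivity
  refine ⟨(hUi.add hwi).mono' (hmeas.norm.aemeasurable.pow_const _).aestronglyMeasurable
    (ae_of_all _ fun x => ?_), ?_⟩
  · rw [Real.norm_eq_abs, abs_of_nonneg (hnn x)]; exact hle x
  · calc _ ≤ ∫ x, (U.indicator (fun _ => (1 : ℝ)) x + |w x| ^ m) :=
          integral_mono_of_nonneg (ae_of_all _ hnn) (hUi.add hwi) (ae_of_all _ hle)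
      _ = volume.real U + ∫ x, |w x| ^ m := by
          rw [integral_add hUi hwi, integral_indicator hU]; simp
      _ ≤ _ := by gcongr

/-- Subcritical fractional Sobolev embedding, for families of functions supported in a set of
finite measure. -/
theorem boundedInLp_of_lt_criticalExponent (hN : 0 < N) (hs : 0 < s) (hp : 0 < p)
    {F : Set (Space N → ℝ)} {U : Set (Space N)} {r M : ℝ}
    (hU : MeasurableSet U) (hUfin : volume U ≠ ⊤) (hr : 0 < r)
    (hrc : (r : EReal) < criticalExponent N s p)
    (hF : ∀ w ∈ F, AEStronglyMeasurable w ∧ (∀ x ∉ U, w x = 0) ∧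
      Integrable (gagliardoKernel s p w) ∧ ∫ z, gagliardoKernel s p w z ≤ M)
    (h1 : BoundedInLp F 1) : BoundedInLp F r := by
  by_contra hcon
  have hN' : (0 : ℝ) < N := by exact_mod_cast hN
  set S := {m : ℝ | 1 ≤ m ∧ BoundedInLp F m} with hS
  have hSr : ∀ m ∈ S, m ≤ r := fun m hm => by
    by_contra! hlt
    exact hcon (hm.2.mono_exponent hU hUfin hr hlt.le fun w hw => ⟨(hF w hw).1, (hF w hw).2.1⟩)
  have hSb : BddAbove S := ⟨r, hSr⟩
  have h1S : (1 : ℝ) ∈ S := ⟨le_rfl, h1⟩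
  set a := s * p / N with ha
  have hapos : 0 < a := by positivity
  -- A supremum replaces the iteration of the gain: closure of `S` under it forces `a · sSup S ≤
  -- sSup S - p`. Hence `a < 1` and `sSup S` is at least the critical exponent, against `sSup S ≤
  -- r`.
  have hstep : ∀ m ∈ S, m ≤ (sSup S - p) / a := fun m hm => by
    rw [le_div_iff₀ hapos]
    have hb := hm.2.gain hN hs hp (zero_lt_one.trans_le hm.1)
      (fun w hw => ⟨(hF w hw).1, (hF w hw).2.2⟩)
    rcases le_total 1 (p + a * m) with h | h
    · have := le_csSup hSb (show p + a * m ∈ S from ⟨h, hb⟩)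
      linarith
    · have := le_csSup hSb h1S
      linarith
  have hsup := csSup_le ⟨1, h1S⟩ hstep
  rw [le_div_iff₀ hapos] at hsup
  have hsup1 : 1 ≤ sSup S := le_csSup hSb h1S
  have hsupr : sSup S ≤ r := csSup_le ⟨1, h1S⟩ hSr
  have ha1 : a < 1 := by nlinarith
  have hsp : s * p < N := by rwa [ha, div_lt_one hN'] at ha1
  rw [criticalExponent, if_pos hsp, EReal.coe_lt_coe_iff, lt_div_iff₀ (by linarith)] at hrc
  have : a * N = s * p := by rw [ha]; field_simp
  have h3 : (sSup S * a) * N ≤ (sSup S - p) * N := by gcongr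
  have h4 : sSup S * (N - s * p) ≤ r * (N - s * p) := by
    have : 0 ≤ N - s * p := by linarith
    gcongr
  nlinarith

end Embedding

end FracKirchhoff

/-! ### Vitali convergence of the logarithmic integrals -/

namespace FracKirchhoff

section Vitali

open Filter Topology

variable {α : Type*} [MeasurableSpace α] {μ : Measure α}

theorem exists_subseq_ae_tendsto {ι : Type*} {l : Filter ι} {u v : ι → Lp ℝ 2 μ}
    {u' v' : Lp ℝ 2 μ} (hu : Tendsto u l (𝓝 u')) (hv : Tendsto v l (𝓝 v')) {ns : ℕ → ι}
    (hns : Tendsto ns atTop l) : ∃ ms : ℕ → ℕ, StrictMono ms ∧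
      (∀ᵐ x ∂μ, Tendsto (fun n => u (ns (ms n)) x) atTop (𝓝 (u' x))) ∧
      ∀ᵐ x ∂μ, Tendsto (fun n => v (ns (ms n)) x) atTop (𝓝 (v' x)) := by
  obtain ⟨m₁, hm₁, h₁⟩ := (tendstoInMeasure_of_tendsto_Lp (hu.comp hns)).exists_seq_tendsto_ae
  obtain ⟨m₂, hm₂, h₂⟩ := (tendstoInMeasure_of_tendsto_Lp
    ((hv.comp hns).comp hm₁.tendsto_atTop)).exists_seq_tendsto_ae
  refine ⟨m₁ ∘ m₂, hm₁.comp hm₂, ?_, h₂⟩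
  filter_upwards [h₁] with x hx
  exact hx.comp hm₂.tendsto_atTop

variable [IsFiniteMeasure μ]

/-- Where `|f n| ≥ K` one has `|f n| ≤ K^(-η) X n`, so the tails are uniformly small. -/
theorem uniformIntegrable_of_rpow_le {f X : ℕ → α → ℝ} {η C : ℝ} (hη : 0 < η)
    (hf : ∀ n, AEStronglyMeasurable (f n) μ) (hX : ∀ n, Integrable (X n) μ)
    (hXC : ∀ n, ∫ x, X n x ∂μ ≤ C) (hfX : ∀ n, ∀ᵐ x ∂μ, |f n x| ^ (1 + η) ≤ X n x) :
    UniformIntegrable f 1 μ := by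
  refine uniformIntegrable_of le_rfl ENNReal.one_ne_top hf fun ε hε => ?_
  have hlim : Tendsto (fun K : ℝ => K ^ (-η) * |C|) atTop (𝓝 (0 * |C|)) :=
    (tendsto_rpow_neg_atTop hη).mul_const _
  rw [zero_mul] at hlim
  obtain ⟨K, hK, hK0⟩ := ((hlim.eventually (gt_mem_nhds hε)).and (eventually_gt_atTop 0)).exists
  refine ⟨⟨K, hK0.le⟩, fun n => ?_⟩
  have hXnn : 0 ≤ᵐ[μ] X n := by
    filter_upwards [hfX n] with x hx
    exact (Real.rpow_nonneg (abs_nonneg _) _).trans hx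
  rw [eLpNorm_one_eq_lintegral_enorm]
  calc _ ≤ ∫⁻ x, ENNReal.ofReal (K ^ (-η) * X n x) ∂μ := by
        refine lintegral_mono_ae ?_
        filter_upwards [hfX n, hXnn] with x hx hx0
        by_cases hxK : (⟨K, hK0.le⟩ : NNReal) ≤ ‖f n x‖₊
        · rw [indicator_of_mem (by exact hxK), Real.enorm_eq_ofReal_abs]
          refine ENNReal.ofReal_le_ofReal ?_
          have hKf : K ≤ |f n x| := hxK
          have hfpos : 0 < |f n x| := hK0.trans_le hKf
          have h1 : K ^ η ≤ |f n x| ^ η := by gcongr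
          rw [Real.rpow_add hfpos, Real.rpow_one] at hx
          rw [Real.rpow_neg hK0.le, inv_mul_eq_div, le_div_iff₀ (by positivity)]
          exact (mul_le_mul_of_nonneg_left h1 hfpos.le).trans hx
        · rw [indicator_of_notMem (by exact hxK)]; simp
    _ = ENNReal.ofReal (K ^ (-η) * ∫ x, X n x ∂μ) := by
        rw [← ofReal_integral_eq_lintegral_ofReal ((hX n).const_mul _), integral_const_mul]
        filter_upwards [hXnn] with x hx
        exact mul_nonneg (Real.rpow_nonneg hK0.le _) hx
    _ ≤ ENNReal.ofReal ε := by
        refine ENNReal.ofReal_le_ofReal (le_trans ?_ hK.le)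
        gcongr
        exact (hXC n).trans (le_abs_self C)

theorem tendsto_integral_of_rpow_le {f X : ℕ → α → ℝ} {g : α → ℝ} {η C : ℝ} (hη : 0 < η)
    (hf : ∀ n, AEStronglyMeasurable (f n) μ) (hX : ∀ n, Integrable (X n) μ)
    (hXC : ∀ n, ∫ x, X n x ∂μ ≤ C) (hfX : ∀ n, ∀ᵐ x ∂μ, |f n x| ^ (1 + η) ≤ X n x)
    (hfg : ∀ᵐ x ∂μ, Tendsto (fun n => f n x) atTop (𝓝 (g x))) :
    Tendsto (fun n => ∫ x, f n x ∂μ) atTop (𝓝 (∫ x, g x ∂μ)) := by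
  have hui := uniformIntegrable_of_rpow_le hη hf hX hXC hfX
  have hg : MemLp g 1 μ := hui.memLp_of_ae_tendsto hfg
  have hLp := tendsto_Lp_finite_of_tendsto_ae le_rfl ENNReal.one_ne_top hf hg
    hui.unifIntegrable hfg
  exact tendsto_integral_of_L1' g (memLp_one_iff_integrable.1 hg).1
    (Eventually.of_forall fun n => memLp_one_iff_integrable.1 (hui.memLp n)) hLp

/-- The odd logarithmic power `y ↦ |y|^(σ-2) y log |y|`. -/
noncomputable def logPow (σ y : ℝ) : ℝ := |y| ^ (σ - 2) * (y * Real.log y)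

theorem continuous_logPow {σ : ℝ} (hσ : 2 < σ) : Continuous (logPow σ) :=
  (continuous_abs.rpow_const fun _ => Or.inr (by linarith)).mul Real.continuous_mul_log

theorem abs_logPow_le {σ ε : ℝ} (hσ : 2 < σ) (hε : 0 < ε) (y : ℝ) :
    |logPow σ y| ≤ (1 + 1 / ε) * max 1 |y| ^ (σ - 1 + ε) := by
  rw [logPow, abs_mul, abs_of_nonneg (Real.rpow_nonneg (abs_nonneg y) _), abs_mul,
    ← Real.log_abs y]
  rcases le_total |y| 1 with h | h
  · rw [max_eq_left h, Real.one_rpow, mul_one]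
    have h1 : |y| ^ (σ - 2) ≤ 1 := Real.rpow_le_one (abs_nonneg _) h (by linarith)
    have h2 : |y| * abs (Real.log |y|) ≤ 1 := by
      rcases eq_or_lt_of_le (abs_nonneg y) with h0 | h0
      · rw [← h0]; simp
      · have := Real.abs_log_mul_self_lt |y| h0 h
        rw [abs_mul, abs_abs, mul_comm] at this
        exact this.le
    have h3 : 0 ≤ 1 / ε := by positivity
    calc _ ≤ 1 * 1 := mul_le_mul h1 h2 (by positivity) zero_le_one
      _ ≤ _ := by linarith
  · have hy : 0 < |y| := by linarith
    rw [max_eq_right h, abs_of_nonneg (Real.log_nonneg h)]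
    have h1 := Real.log_le_rpow_div hy.le hε
    calc |y| ^ (σ - 2) * (|y| * Real.log |y|) ≤ |y| ^ (σ - 2) * (|y| * (|y| ^ ε / ε)) := by gcongr
      _ = 1 / ε * |y| ^ (σ - 1 + ε) := by
          rw [show σ - 1 + ε = (σ - 2) + 1 + ε by ring, Real.rpow_add hy, Real.rpow_add hy,
            Real.rpow_one]
          ring
      _ ≤ _ := by
          have : 0 ≤ |y| ^ (σ - 1 + ε) := by positivity
          linarith

/-- The slack in `k σ < 1` pays both for the logarithm, bounded by a power `ε`, and for the extra
integrability `1 + ε` required by Vitali's theorem. -/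
theorem exists_subcritical_gap {k σ : ℝ} (hk : 0 < k) (hσ : 2 < σ) (hkσ : k * σ < 1) :
    ∃ ε > 0, k * (σ + ε) * (1 + ε) ≤ 1 := by
  have h1 : 0 < (1 - k * σ) / (k * (σ + 2)) := by
    have : 0 < 1 - k * σ := by linarith
    positivity
  set ε := min 1 ((1 - k * σ) / (k * (σ + 2))) with hε
  have hεpos : 0 < ε := lt_min one_pos h1
  have hε1 : ε ≤ 1 := min_le_left _ _
  have hε2 : ε * (k * (σ + 2)) ≤ 1 - k * σ := by
    rw [← le_div_iff₀ (by positivity)]; exact min_le_right _ _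
  refine ⟨ε, hεpos, ?_⟩
  have : (σ + ε) * (1 + ε) ≤ σ + ε * (σ + 2) := by nlinarith
  nlinarith

/-- Each factor is bounded by a power of the single integrable quantity `X`; the gap condition says
that the total power does not exceed one. -/
theorem abs_logPow_mul_le {σ r₁ r₂ ε a b c X : ℝ} (hσ : 2 < σ) (hr₁ : 0 < r₁) (hr₂ : 0 < r₂)
    (hε : 0 < ε) (hgap : (1 / r₁ + 1 / r₂) * (σ + ε) * (1 + ε) ≤ 1) (hX : 1 ≤ X)
    (ha : |a| ^ r₁ ≤ X) (hb : |b| ^ r₂ ≤ X) (hc : |c| ≤ 2 * X ^ (1 / r₁)) :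
    |logPow σ (a * b) * b * c| ^ (1 + ε) ≤ ((1 + 1 / ε) * 2) ^ (1 + ε) * X := by
  have hX0 : 0 < X := by linarith
  have ha' : |a| ≤ X ^ (1 / r₁) := by
    rw [one_div]; exact (Real.le_rpow_inv_iff_of_pos (abs_nonneg _) hX0.le hr₁).2 ha
  have hb' : |b| ≤ X ^ (1 / r₂) := by
    rw [one_div]; exact (Real.le_rpow_inv_iff_of_pos (abs_nonneg _) hX0.le hr₂).2 hb
  set k := 1 / r₁ + 1 / r₂ with hk
  have hkpos : 0 < k := by positivity
  have hXk : X ^ k = X ^ (1 / r₁) * X ^ (1 / r₂) := Real.rpow_add hX0 _ _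
  clear_value k
  have hab : max 1 |a * b| ≤ X ^ k := by
    refine max_le (Real.one_le_rpow hX hkpos.le) ?_
    rw [abs_mul, hXk]; gcongr
  have hbc : |b| * |c| ≤ 2 * X ^ k := by
    rw [hXk]
    calc |b| * |c| ≤ X ^ (1 / r₂) * (2 * X ^ (1 / r₁)) := by gcongr
      _ = _ := by ring
  have h1 : |logPow σ (a * b) * b * c| ≤ (1 + 1 / ε) * 2 * X ^ (k * (σ + ε)) := by
    rw [abs_mul, abs_mul, mul_assoc]
    calc _ ≤ ((1 + 1 / ε) * (X ^ k) ^ (σ - 1 + ε)) * (2 * X ^ k) := by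
          refine mul_le_mul ((abs_logPow_le hσ hε _).trans ?_) hbc (by positivity) (by positivity)
          have : 0 ≤ σ - 1 + ε := by linarith
          gcongr
      _ = _ := by
          rw [← Real.rpow_mul hX0.le, show k * (σ + ε) = k * (σ - 1 + ε) + k by ring,
            Real.rpow_add hX0]
          ring
  calc _ ≤ ((1 + 1 / ε) * 2 * X ^ (k * (σ + ε))) ^ (1 + ε) := by gcongr
    _ = ((1 + 1 / ε) * 2) ^ (1 + ε) * X ^ (k * (σ + ε) * (1 + ε)) := by
        rw [Real.mul_rpow (by positivity) (by positivity), ← Real.rpow_mul hX0.le]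
    _ ≤ ((1 + 1 / ε) * 2) ^ (1 + ε) * X ^ (1 : ℝ) := by gcongr
    _ = _ := by rw [Real.rpow_one]

theorem tendsto_integral_logPow_seq {σ r₁ r₂ C : ℝ} (hσ : 2 < σ) (hr₁ : 0 < r₁) (hr₂ : 0 < r₂)
    (hgap : (1 / r₁ + 1 / r₂) * σ < 1) {a b c : ℕ → α → ℝ} {a' b' c' : α → ℝ}
    (ham : ∀ n, AEStronglyMeasurable (a n) μ) (hbm : ∀ n, AEStronglyMeasurable (b n) μ)
    (hcm : ∀ n, AEStronglyMeasurable (c n) μ)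
    (ha : ∀ n, Integrable (fun x => |a n x| ^ r₁) μ ∧ ∫ x, |a n x| ^ r₁ ∂μ ≤ C)
    (hb : ∀ n, Integrable (fun x => |b n x| ^ r₂) μ ∧ ∫ x, |b n x| ^ r₂ ∂μ ≤ C)
    (ha' : Integrable (fun x => |a' x| ^ r₁) μ) (hc : ∀ n x, |c n x| ≤ |a n x| + |a' x|)
    (hat : ∀ᵐ x ∂μ, Tendsto (fun n => a n x) atTop (𝓝 (a' x)))
    (hbt : ∀ᵐ x ∂μ, Tendsto (fun n => b n x) atTop (𝓝 (b' x)))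
    (hct : ∀ᵐ x ∂μ, Tendsto (fun n => c n x) atTop (𝓝 (c' x))) :
    Tendsto (fun n => ∫ x, logPow σ (a n x * b n x) * b n x * c n x ∂μ) atTop
      (𝓝 (∫ x, logPow σ (a' x * b' x) * b' x * c' x ∂μ)) := by
  obtain ⟨ε, hε, hgap'⟩ := exists_subcritical_gap (k := 1 / r₁ + 1 / r₂) (by positivity) hσ hgap
  set D := ((1 + 1 / ε) * 2) ^ (1 + ε) with hD
  have hD0 : 0 ≤ D := by positivity
  set X : ℕ → α → ℝ := fun n x => 1 + |a n x| ^ r₁ + |b n x| ^ r₂ + |a' x| ^ r₁ with hX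
  have hXi : ∀ n, Integrable (X n) μ := fun n =>
    (((integrable_const 1).add (ha n).1).add (hb n).1).add ha'
  refine tendsto_integral_of_rpow_le (X := fun n x => D * X n x)
    (C := D * (μ.real univ + C + C + ∫ x, |a' x| ^ r₁ ∂μ)) hε (fun n => ?_)
    (fun n => (hXi n).const_mul D) (fun n => ?_) (fun n => ae_of_all _ fun x => ?_) ?_
  · exact (((continuous_logPow hσ).comp_aestronglyMeasurable ((ham n).mul (hbm n))).mul
      (hbm n)).mul (hcm n)
  · rw [integral_const_mul]
    refine mul_le_mul_of_nonneg_left ?_ hD0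
    simp only [hX]
    have i₁ : Integrable (fun x => 1 + |a n x| ^ r₁) μ := (integrable_const 1).add (ha n).1
    have i₂ : Integrable (fun x => 1 + |a n x| ^ r₁ + |b n x| ^ r₂) μ := i₁.add (hb n).1
    rw [integral_add i₂ ha', integral_add i₁ (hb n).1, integral_add (integrable_const 1) (ha n).1]
    have := (ha n).2
    have := (hb n).2
    simp only [integral_const, smul_eq_mul, mul_one]
    linarith
  · have h1 : 0 ≤ |a n x| ^ r₁ := by positivity
    have h2 : 0 ≤ |b n x| ^ r₂ := by positivity
    have h3 : 0 ≤ |a' x| ^ r₁ := by positivity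
    have hX1 : 1 ≤ X n x := by simp only [hX]; linarith
    have hX0 : 0 ≤ X n x := by linarith
    have hroot : ∀ y : ℝ, |y| ^ r₁ ≤ X n x → |y| ≤ X n x ^ (1 / r₁) := fun y hy => by
      rw [one_div]; exact (Real.le_rpow_inv_iff_of_pos (abs_nonneg _) hX0 hr₁).2 hy
    have haX : |a n x| ^ r₁ ≤ X n x := by simp only [hX]; linarith
    refine abs_logPow_mul_le hσ hr₁ hr₂ hε hgap' hX1 haX
      (by simp only [hX]; linarith) ((hc n x).trans ?_)
    have := hroot _ haX
    have := hroot (a' x) (by simp only [hX]; linarith)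
    linarith
  · filter_upwards [hat, hbt, hct] with x h1 h2 h3
    exact ((((continuous_logPow hσ).tendsto _).comp (h1.mul h2)).mul h2).mul h3

/-- Convergence in `L²` yields a.e. convergence only along subsequences, which suffices for a
countably generated filter. The constants `A`, `B` let one statement serve the test functions `u t`
and `u' - u t`. -/
theorem tendsto_integral_logPow {ι : Type*} {l : Filter ι} [l.IsCountablyGenerated]
    {σ r₁ r₂ C : ℝ} (hσ : 2 < σ) (hr₁ : 0 < r₁) (hr₂ : 0 < r₂)
    (hgap : (1 / r₁ + 1 / r₂) * σ < 1) {u v : ι → Lp ℝ 2 μ} {u' v' : Lp ℝ 2 μ}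
    (hu : Tendsto u l (𝓝 u')) (hv : Tendsto v l (𝓝 v'))
    (hb : ∀ᶠ t in l, (Integrable (fun x => |u t x| ^ r₁) μ ∧ ∫ x, |u t x| ^ r₁ ∂μ ≤ C) ∧
      Integrable (fun x => |v t x| ^ r₂) μ ∧ ∫ x, |v t x| ^ r₂ ∂μ ≤ C)
    (hu' : Integrable (fun x => |u' x| ^ r₁) μ) {A B : ℝ} (hA : |A| ≤ 1) (hB : |B| ≤ 1) :
    Tendsto (fun t => ∫ x, logPow σ (u t x * v t x) * v t x * (A * u' x + B * u t x) ∂μ) l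
      (𝓝 (∫ x, logPow σ (u' x * v' x) * v' x * (A * u' x + B * u' x) ∂μ)) := by
  refine tendsto_of_subseq_tendsto fun ns hns => ?_
  obtain ⟨m₀, hm₀⟩ := eventually_atTop.1 (hns.eventually hb)
  have hns' : Tendsto (fun n => ns (n + m₀)) atTop l := hns.comp (tendsto_add_atTop_nat m₀)
  obtain ⟨ms, hms, h₁, h₂⟩ := exists_subseq_ae_tendsto hu hv hns'
  refine ⟨fun n => ms n + m₀, ?_⟩
  have hbd := fun n => hm₀ (ms n + m₀) (Nat.le_add_left _ _)
  refine tendsto_integral_logPow_seq hσ hr₁ hr₂ hgap (C := C)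
    (a := fun n x => u (ns (ms n + m₀)) x) (b := fun n x => v (ns (ms n + m₀)) x)
    (c := fun n x => A * u' x + B * u (ns (ms n + m₀)) x)
    (fun n => (Lp.aestronglyMeasurable _)) (fun n => (Lp.aestronglyMeasurable _))
    (fun n => ((Lp.aestronglyMeasurable _).const_mul A).add
      ((Lp.aestronglyMeasurable _).const_mul B))
    (fun n => (hbd n).1) (fun n => (hbd n).2) hu' (fun n x => ?_) h₁ h₂ ?_
  · refine (abs_add_le _ _).trans ?_
    rw [abs_mul, abs_mul]
    nlinarith [abs_nonneg (u' x), abs_nonneg (u (ns (ms n + m₀)) x)]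
  · filter_upwards [h₁] with x hx
    exact (hx.const_mul B).const_add (A * u' x)

end Vitali

end FracKirchhoff

/-! ### Gagliardo integrals: stability and lower semicontinuity -/

namespace FracKirchhoff

section Gagliardo

open Filter Topology

variable {N : ℕ} {s p : ℝ}

theorem ae_prod_of_ae {α : Type*} [MeasurableSpace α] {μ : Measure α} [SFinite μ] {P : α → Prop}
    (h : ∀ᵐ x ∂μ, P x) : ∀ᵐ z ∂μ.prod μ, P z.1 ∧ P z.2 :=
  (Measure.quasiMeasurePreserving_fst.ae h).and (Measure.quasiMeasurePreserving_snd.ae h)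

theorem restrict_prod_self (U : Set (Space N)) :
    (volume : Measure (Space N × Space N)).restrict (U ×ˢ U)
      = (volume.restrict U).prod (volume.restrict U) :=
  (Measure.prod_restrict U U).symm

theorem aestronglyMeasurable_gagliardoKernel {μ : Measure (Space N)} [SFinite μ]
    {w : Space N → ℝ} (hw : AEStronglyMeasurable w μ) :
    AEStronglyMeasurable (gagliardoKernel s p w) (μ.prod μ) := by
  have h1 : AEMeasurable (fun z : Space N × Space N => w z.1 - w z.2) (μ.prod μ) :=
    hw.comp_fst.aemeasurable.sub hw.comp_snd.aemeasurable
  have h2 : Measurable fun z : Space N × Space N => ‖z.1 - z.2‖ ^ ((N : ℝ) + s * p) :=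
    (measurable_fst.sub measurable_snd).norm.pow_const _
  exact ((h1.norm.pow_const p).div h2.aemeasurable).aestronglyMeasurable

theorem gagliardoKernel_congr_ae {μ : Measure (Space N)} [SFinite μ] {w w' : Space N → ℝ}
    (h : w =ᵐ[μ] w') : gagliardoKernel s p w =ᵐ[μ.prod μ] gagliardoKernel s p w' := by
  filter_upwards [ae_prod_of_ae h] with z hz
  rw [gagliardoKernel, gagliardoKernel, hz.1, hz.2]

theorem gagliardoKernel_indicator {U : Set (Space N)} {w : Space N → ℝ} {z : Space N × Space N}
    (hz : z ∈ U ×ˢ U) : gagliardoKernel s p (U.indicator w) z = gagliardoKernel s p w z := by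
  rw [gagliardoKernel, gagliardoKernel, indicator_of_mem hz.1, indicator_of_mem hz.2]

theorem gagliardo_nonneg (U : Set (Space N)) (w : Space N → ℝ) : 0 ≤ gagliardo U s p w :=
  integral_nonneg fun z => gagliardoKernel_nonneg z

theorem MemW0.integrableOn {U : Set (Space N)} (hU : MeasurableSet U) {w : Space N → ℝ}
    (h : MemW0 U s p w) : IntegrableOn (gagliardoKernel s p w) (U ×ˢ U) :=
  (integrableOn_congr_fun (fun _ hz => gagliardoKernel_indicator hz) (hU.prod hU)).1
    h.2.integrableOn

theorem rpow_abs_sub_le {a b : ℝ} (hp : 0 < p) : |a - b| ^ p ≤ 2 ^ p * (|a| ^ p + |b| ^ p) := by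
  have h1 : |a - b| ≤ 2 * max |a| |b| := by
    have := abs_sub a b
    have := le_max_left |a| |b|
    have := le_max_right |a| |b|
    linarith
  calc |a - b| ^ p ≤ (2 * max |a| |b|) ^ p := by gcongr
    _ = 2 ^ p * max |a| |b| ^ p := Real.mul_rpow zero_le_two (by positivity)
    _ ≤ _ := by
        gcongr
        have h2 : 0 ≤ |a| ^ p := by positivity
        have h3 : 0 ≤ |b| ^ p := by positivity
        rcases max_choice |a| |b| with h | h <;> rw [h] <;> linarith

theorem gagliardoKernel_sub_le (hp : 0 < p) (w w' : Space N → ℝ) (z : Space N × Space N) :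
    gagliardoKernel s p (w - w') z
      ≤ 2 ^ p * (gagliardoKernel s p w z + gagliardoKernel s p w' z) := by
  simp only [gagliardoKernel, Pi.sub_apply]
  rw [← add_div, mul_div_assoc']
  gcongr
  rw [show w z.1 - w' z.1 - (w z.2 - w' z.2) = (w z.1 - w z.2) - (w' z.1 - w' z.2) by ring]
  exact rpow_abs_sub_le hp

theorem indicator_congr_ae {U : Set (Space N)} (hU : MeasurableSet U) {w w' : Space N → ℝ}
    (h : w =ᵐ[volume.restrict U] w') : U.indicator w =ᵐ[volume] U.indicator w' := by
  filter_upwards [(ae_restrict_iff' hU).1 h] with x hx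
  by_cases hxU : x ∈ U
  · rw [indicator_of_mem hxU, indicator_of_mem hxU, hx hxU]
  · rw [indicator_of_notMem hxU, indicator_of_notMem hxU]

theorem MemW0.congr_ae {U : Set (Space N)} (hU : MeasurableSet U) {w w' : Space N → ℝ}
    (hw : MemW0 U s p w) (h : w =ᵐ[volume.restrict U] w') : MemW0 U s p w' :=
  have h' := indicator_congr_ae hU h
  ⟨(memLp_congr_ae h').1 hw.1, hw.2.congr (gagliardoKernel_congr_ae h')⟩

theorem MemW0.sub {U : Set (Space N)} (hp : 0 < p) {w w' : Space N → ℝ}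
    (hw : MemW0 U s p w) (hw' : MemW0 U s p w') : MemW0 U s p (w - w') := by
  rw [MemW0, indicator_sub']
  refine ⟨hw.1.sub hw'.1, ((hw.2.add hw'.2).const_mul (2 ^ p)).mono'
    (aestronglyMeasurable_gagliardoKernel (hw.1.1.sub hw'.1.1)) (ae_of_all _ fun z => ?_)⟩
  rw [Real.norm_eq_abs, abs_of_nonneg (gagliardoKernel_nonneg _)]
  exact gagliardoKernel_sub_le hp _ _ z

theorem gagliardoKernel_const_smul (c : ℝ) (w : Space N → ℝ) (z : Space N × Space N) :
    gagliardoKernel s p (c • w) z = |c| ^ p * gagliardoKernel s p w z := by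
  simp only [gagliardoKernel, Pi.smul_apply, smul_eq_mul]
  rw [← mul_sub, abs_mul, Real.mul_rpow (abs_nonneg _) (abs_nonneg _), mul_div_assoc]

theorem gagliardo_const_smul (U : Set (Space N)) (c : ℝ) (w : Space N → ℝ) :
    gagliardo U s p (c • w) = |c| ^ p * gagliardo U s p w := by
  simp only [gagliardo, gagliardoKernel_const_smul, integral_const_mul]

theorem MemW0.const_smul {U : Set (Space N)} {w : Space N → ℝ}
    (hw : MemW0 U s p w) (c : ℝ) : MemW0 U s p (c • w) := by
  rw [MemW0, show U.indicator (c • w) = c • U.indicator w from indicator_const_smul U c w]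
  refine ⟨hw.1.const_smul c, (hw.2.const_mul (|c| ^ p)).congr (ae_of_all _ fun z => ?_)⟩
  exact (gagliardoKernel_const_smul c _ z).symm

theorem gagliardo_congr_ae {U : Set (Space N)} {w w' : Space N → ℝ}
    (h : w =ᵐ[volume.restrict U] w') : gagliardo U s p w = gagliardo U s p w' := by
  refine integral_congr_ae ?_
  rw [restrict_prod_self]
  exact gagliardoKernel_congr_ae h

/-- Lower semicontinuity of the Gagliardo double integral with respect to convergence in `L²`. -/
theorem eventually_lt_gagliardo {ι : Type*} {l : Filter ι} [l.IsCountablyGenerated]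
    (hp : 0 < p) {U : Set (Space N)} {u : ι → L2 U} {u' : L2 U} (hu : Tendsto u l (𝓝 u'))
    (hi : ∀ᶠ t in l, IntegrableOn (gagliardoKernel s p (u t)) (U ×ˢ U))
    (hi' : IntegrableOn (gagliardoKernel s p u') (U ×ˢ U)) {ε : ℝ} (hε : 0 < ε) :
    ∀ᶠ t in l, gagliardo U s p u' - ε < gagliardo U s p (u t) := by
  by_contra hcon
  rw [not_eventually] at hcon
  obtain ⟨ns, hns, hP⟩ := exists_seq_forall_of_frequently (hcon.and_eventually hi)
  obtain ⟨ms, -, hms, -⟩ := exists_subseq_ae_tendsto hu hu hns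
  have hlim : ∀ᵐ z ∂(volume : Measure (Space N × Space N)).restrict (U ×ˢ U),
      Tendsto (fun n => ENNReal.ofReal (gagliardoKernel s p (u (ns (ms n))) z)) atTop
        (𝓝 (ENNReal.ofReal (gagliardoKernel s p u' z))) := by
    rw [restrict_prod_self]
    filter_upwards [ae_prod_of_ae hms] with z hz
    refine ENNReal.tendsto_ofReal (Tendsto.div_const ?_ _)
    exact ((hz.1.sub hz.2).abs).rpow_const (Or.inr hp.le)
  have hfatou := lintegral_liminf_le' (u := atTop)
    (μ := (volume : Measure (Space N × Space N)).restrict (U ×ˢ U))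
    (f := fun n z => ENNReal.ofReal (gagliardoKernel s p (u (ns (ms n))) z))
    fun n => (hP (ms n)).2.1.aemeasurable.ennreal_ofReal
  have hG : ∫⁻ z in U ×ˢ U, ENNReal.ofReal (gagliardoKernel s p u' z)
      = ENNReal.ofReal (gagliardo U s p u') :=
    (ofReal_integral_eq_lintegral_ofReal hi' (ae_of_all _ fun z => gagliardoKernel_nonneg z)).symm
  have hGn : ∀ n, ∫⁻ z in U ×ˢ U, ENNReal.ofReal (gagliardoKernel s p (u (ns (ms n))) z)
      ≤ ENNReal.ofReal (gagliardo U s p u' - ε) := fun n => by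
    rw [← ofReal_integral_eq_lintegral_ofReal (hP (ms n)).2
      (ae_of_all _ fun z => gagliardoKernel_nonneg z)]
    exact ENNReal.ofReal_le_ofReal (not_lt.1 (hP (ms n)).1)
  rw [lintegral_congr_ae (g := fun z => ENNReal.ofReal (gagliardoKernel s p u' z))
    (hlim.mono fun z hz => hz.liminf_eq), hG] at hfatou
  have h2 : ENNReal.ofReal (gagliardo U s p u') ≤ ENNReal.ofReal (gagliardo U s p u' - ε) :=
    hfatou.trans (liminf_le_of_frequently_le' (Frequently.of_forall hGn))
  -- Excludes truncation by `ENNReal.ofReal`, so that the inequality of Fatou's lemma can be read in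
  -- `ℝ`.
  have h3 : 0 ≤ gagliardo U s p u' - ε :=
    (gagliardo_nonneg U _).trans (not_lt.1 (hP (ms 0)).1)
  rw [ENNReal.ofReal_le_ofReal_iff h3] at h2
  linarith

end Gagliardo

/-! ### Convexity of the Gagliardo energy -/

section Convexity

variable {N : ℕ} {r : ℝ}

theorem abs_rpow_sub_one_mul_le (hr : 1 < r) (a c : ℝ) :
    |a| ^ (r - 1) * |c| ≤ (1 - 1 / r) * |a| ^ r + 1 / r * |c| ^ r := by
  have hc := (Real.HolderConjugate.conjExponent hr).symm
  have h := Real.young_inequality_of_nonneg (a := |a| ^ (r - 1)) (b := |c|) (by positivity)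
    (abs_nonneg c) hc
  rw [← Real.rpow_mul (abs_nonneg a), Real.conjExponent,
    mul_div_cancel₀ _ (by linarith : r - 1 ≠ 0)] at h
  have h1 : (1 : ℝ) - 1 / r = 1 / (r / (r - 1)) := by
    have : r - 1 ≠ 0 := by linarith
    field_simp
  rw [h1]
  refine h.trans (le_of_eq ?_)
  ring

theorem abs_rpow_sub_two_mul_self {a : ℝ} (hr : 1 < r) : |a| ^ (r - 2) * a * a = |a| ^ r := by
  rcases eq_or_ne a 0 with rfl | ha
  · rw [abs_zero, Real.zero_rpow (show r ≠ 0 by linarith), mul_zero]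
  · rw [mul_assoc, ← abs_mul_abs_self a, ← pow_two, ← Real.rpow_two,
      ← Real.rpow_add (abs_pos.2 ha)]
    ring_nf

theorem abs_abs_rpow_sub_two_mul {a : ℝ} (hr : 1 < r) : |a| ^ (r - 2) * |a| = |a| ^ (r - 1) := by
  rcases eq_or_ne a 0 with rfl | ha
  · rw [abs_zero, Real.zero_rpow (by linarith : r - 1 ≠ 0), mul_zero]
  · nth_rw 2 [← Real.rpow_one |a|]
    rw [← Real.rpow_add (abs_pos.2 ha)]
    ring_nf

/-- The tangent-line inequality for the convex function `|·|^r / r`, obtained from Young's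
inequality. -/
theorem abs_rpow_pairing_le (hr : 1 < r) (a c : ℝ) :
    |a| ^ (r - 2) * a * (c - a) ≤ 1 / r * (|c| ^ r - |a| ^ r) := by
  have h1 := abs_rpow_sub_one_mul_le hr a c
  have h2 : |a| ^ (r - 2) * a * c ≤ |a| ^ (r - 1) * |c| := by
    rw [← abs_abs_rpow_sub_two_mul hr, mul_assoc, mul_assoc, ← abs_mul]
    gcongr
    exact le_abs_self _
  rw [mul_sub, abs_rpow_sub_two_mul_self hr]
  linarith

theorem abs_abs_rpow_pairing_le (hr : 1 < r) (a c : ℝ) :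
    |(|a| ^ (r - 2) * a * (c - a))| ≤ 2 * |a| ^ r + |c| ^ r := by
  have h1 := abs_rpow_sub_one_mul_le hr a c
  have hr1 : 1 / r ≤ 1 := by rw [div_le_one (by linarith)]; exact hr.le
  have hr0 : 0 ≤ 1 / r := by positivity
  have h3 : 0 ≤ |a| ^ r := by positivity
  have h4 : 0 ≤ |c| ^ r := by positivity
  have h5 : |a| ^ (r - 1) * |a| = |a| ^ r := by
    rw [← abs_abs_rpow_sub_two_mul hr, mul_assoc, abs_mul_abs_self, ← mul_assoc,
      abs_rpow_sub_two_mul_self hr]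
  rw [abs_mul, abs_mul, abs_of_nonneg (Real.rpow_nonneg (abs_nonneg a) _),
    abs_abs_rpow_sub_two_mul hr]
  calc _ ≤ |a| ^ (r - 1) * (|c| + |a|) := by gcongr; exact abs_sub _ _
    _ ≤ _ := by rw [mul_add, h5]; nlinarith

theorem System.fracLaplacePairing_self (S : System N) (hr : 1 < r) (u : Space N → ℝ) :
    S.fracLaplacePairing r u u = gagliardo S.U S.s r u := by
  simp only [System.fracLaplacePairing, gagliardo, gagliardoKernel, abs_rpow_sub_two_mul_self hr]

/-- The tangent-line inequality integrated against the kernel: the operator is a subgradient of the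
bracket. It turns the equation tested with `u t₀ - u τ` into an upper bound for the bracket at time
`τ`. -/
theorem System.fracLaplacePairing_sub_le (S : System N) (hr : 1 < r) {u c w : Space N → ℝ}
    (hum : AEStronglyMeasurable u (volume.restrict S.U))
    (hcm : AEStronglyMeasurable c (volume.restrict S.U))
    (hu : IntegrableOn (gagliardoKernel S.s r u) (S.U ×ˢ S.U))
    (hc : IntegrableOn (gagliardoKernel S.s r c) (S.U ×ˢ S.U))
    (hw : w =ᵐ[volume.restrict S.U] c - u) :
    S.fracLaplacePairing r u w ≤ S.bracket r c - S.bracket r u := by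
  set Φ : Space N × Space N → ℝ := fun z => |u z.1 - u z.2| ^ (r - 2) * (u z.1 - u z.2) *
    ((c z.1 - c z.2) - (u z.1 - u z.2)) / ‖z.1 - z.2‖ ^ ((N : ℝ) + S.s * r) with hΦ
  have hden : ∀ z : Space N × Space N, 0 ≤ ‖z.1 - z.2‖ ^ ((N : ℝ) + S.s * r) :=
    fun z => by positivity
  have h1 : S.fracLaplacePairing r u w = ∫ z in S.U ×ˢ S.U, Φ z := by
    refine integral_congr_ae ?_
    rw [restrict_prod_self]
    filter_upwards [ae_prod_of_ae hw] with z hz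
    simp only [hΦ, hz.1, hz.2, Pi.sub_apply]
    ring
  have hΦm : AEStronglyMeasurable Φ (volume.restrict (S.U ×ˢ S.U)) := by
    rw [restrict_prod_self]
    have h1 := hum.comp_fst (ν := volume.restrict S.U)
    have h2 := hum.comp_snd (μ := volume.restrict S.U)
    have h3 := hcm.comp_fst (ν := volume.restrict S.U)
    have h4 := hcm.comp_snd (μ := volume.restrict S.U)
    have hm : Measurable fun z : Space N × Space N => ‖z.1 - z.2‖ ^ ((N : ℝ) + S.s * r) :=
      (measurable_fst.sub measurable_snd).norm.pow_const _
    have h5 := h1.aemeasurable.sub h2.aemeasurable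
    have h6 := h3.aemeasurable.sub h4.aemeasurable
    exact ((((h5.norm.pow_const (r - 2)).mul h5).mul (h6.sub h5)).div
      hm.aemeasurable).aestronglyMeasurable
  have hΦi : IntegrableOn Φ (S.U ×ˢ S.U) := by
    refine ((hu.const_mul 2).add hc).mono' hΦm (ae_of_all _ fun z => ?_)
    simp only [hΦ, Pi.add_apply, gagliardoKernel]
    rw [Real.norm_eq_abs, abs_div, abs_of_nonneg (hden z), mul_div_assoc', ← add_div]
    gcongr
    exact abs_abs_rpow_pairing_le hr _ _
  rw [h1, System.bracket, System.bracket, ← mul_sub, gagliardo, gagliardo, ← integral_sub hc hu,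
    ← integral_const_mul]
  refine setIntegral_mono hΦi ((hc.sub hu).const_mul _) fun z => ?_
  simp only [hΦ, gagliardoKernel]
  rw [← sub_div, mul_div_assoc']
  exact div_le_div_of_nonneg_right (abs_rpow_pairing_le hr _ _) (hden z)

end Convexity

/-! ### One-sided control of the Kirchhoff term -/

section Kirchhoff

/-- Near `z₀` continuity gives `ε`. If `z ≥ z₀ + η`, the bound on `K z (z - z₀)` forces `K z ≤ e /
η`, hence `K z * z ≤ (1 + z₀ / η) e`, while monotonicity gives the sign. Values far below `z₀` are
excluded by assumption; lower semicontinuity will ensure this. -/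
theorem abs_sub_le_of_monotoneOn {K : ℝ → ℝ} (hc : ContinuousOn K (Ici 0))
    (hmono : MonotoneOn K (Ici 0)) (hnn : ∀ z, 0 ≤ z → 0 ≤ K z) {z₀ ε : ℝ} (hz₀ : 0 ≤ z₀)
    (hε : 0 < ε) : ∃ C > 0, ∃ η > 0, ∀ z e, 0 ≤ z → 0 ≤ e → z₀ - η < z → K z * (z - z₀) ≤ e →
      |K z * z - K z₀ * z₀| ≤ ε + C * e := by
  have hcont : ContinuousOn (fun z => K z * z) (Ici 0) := hc.mul continuousOn_id
  obtain ⟨η, hη, hηb⟩ := Metric.continuousOn_iff.1 hcont z₀ hz₀ ε hε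
  refine ⟨1 + z₀ / η, by positivity, η, hη, fun z e hz he hlow hKe => ?_⟩
  have hCe : 0 ≤ (1 + z₀ / η) * e := by positivity
  rcases lt_or_ge z (z₀ + η) with h | h
  · have h1 : dist z z₀ < η := by rw [Real.dist_eq, abs_lt]; constructor <;> linarith
    have h2 := hηb z hz h1
    rw [Real.dist_eq] at h2
    linarith
  · have hKz := hnn z hz
    have hm := hmono (mem_Ici.2 hz₀) (mem_Ici.2 hz) (by linarith)
    have h1 : K z * η ≤ e := (mul_le_mul_of_nonneg_left (by linarith) hKz).trans hKe
    have h2 : K z ≤ e / η := (le_div_iff₀ hη).2 h1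
    have h3 : K z * z₀ ≤ z₀ / η * e := by
      calc K z * z₀ ≤ e / η * z₀ := by gcongr
        _ = _ := by ring
    have h4 : K z₀ * z₀ ≤ K z * z :=
      mul_le_mul hm (by linarith) hz₀ hKz
    rw [abs_of_nonneg (by linarith)]
    have := mul_nonneg (hnn z₀ hz₀) hz₀
    nlinarith

end Kirchhoff

/-! ### Rewriting the logarithmic nonlinearity -/

section LogPow

variable {σ : ℝ}

theorem logPow_mul_eq (hσ : 2 < σ) (a b : ℝ) :
    |b| ^ σ * |a| ^ (σ - 2) * a * Real.log |a * b| = logPow σ (a * b) * b := by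
  rw [logPow, Real.log_abs, abs_mul, Real.mul_rpow (abs_nonneg _) (abs_nonneg _),
    ← abs_rpow_sub_two_mul_self (a := b) (by linarith : 1 < σ)]
  ring

theorem logPow_mul_mul_eq (hσ : 2 < σ) (a b : ℝ) :
    |a| ^ σ * |b| ^ σ * Real.log |a * b| = logPow σ (a * b) * b * a := by
  rw [← logPow_mul_eq hσ, ← abs_rpow_sub_two_mul_self (a := a) (by linarith : 1 < σ)]
  ring

end LogPow

end FracKirchhoff

/-! ### Differentiability of the squared norm at every time -/

namespace FracKirchhoff

section Derivative

open Filter Topology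

variable {N : ℕ}

/-- A weak solution of one of the two equations has `‖u‖² / 2` differentiable at every time, even
though the energy is only known to be lower semicontinuous along the trajectory. -/
theorem System.hasDerivWithinAt_half_norm_sq (S : System N) {r r₁ r₂ C T t₀ : ℝ}
    {u v g : ℝ → L2 S.U} {u₀ : L2 S.U} (hU : MeasurableSet S.U) (hUfin : volume S.U ≠ ⊤)
    (hσ : 2 < S.σ) (hr : 1 < r) (hKc : ContinuousOn S.K (Ici 0)) (hKm : MonotoneOn S.K (Ici 0))
    (hKnn : ∀ z, 0 ≤ z → 0 ≤ S.K z) (hr₁ : 0 < r₁) (hr₂ : 0 < r₂)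
    (hgap : (1 / r₁ + 1 / r₂) * S.σ < 1)
    (hg : MemLp g 2 (volume.restrict (Ioc 0 T)))
    (hu : ∀ t ∈ Icc 0 T, u t = u₀ + ∫ τ in (0 : ℝ)..t, g τ) (ht₀ : t₀ ∈ Icc 0 T)
    (hv : Tendsto v (𝓝[Icc 0 T] t₀) (𝓝 (v t₀)))
    (hW : ∀ t ∈ Icc 0 T, MemW0 S.U S.s r (u t))
    (hub : ∀ t ∈ Icc 0 T, IntegrableOn (fun x => |u t x| ^ r₁) S.U ∧
      ∫ x in S.U, |u t x| ^ r₁ ≤ C)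
    (hvb : ∀ t ∈ Icc 0 T, IntegrableOn (fun x => |v t x| ^ r₂) S.U ∧
      ∫ x in S.U, |v t x| ^ r₂ ≤ C)
    (heq : ∀ᵐ τ : ℝ, τ ∈ Ioc 0 T → ∀ w : L2 S.U, MemW0 S.U S.s r w →
      inner ℝ (g τ) w + S.K (S.bracket r (u τ)) * S.fracLaplacePairing r (u τ) w
        = ∫ x in S.U, logPow S.σ (u τ x * v τ x) * v τ x * w x) :
    HasDerivWithinAt (fun t => ‖u t‖ ^ 2 / 2)
      ((∫ x in S.U, logPow S.σ (u t₀ x * v t₀ x) * v t₀ x * u t₀ x)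
        - S.K (S.bracket r (u t₀)) * gagliardo S.U S.s r (u t₀)) (Icc 0 T) t₀ := by
  have : IsFiniteMeasure (volume.restrict S.U) := ⟨by simpa using hUfin.lt_top⟩
  have hr0 : 0 < r := by linarith
  have hut : Tendsto u (𝓝[Icc 0 T] t₀) (𝓝 (u t₀)) := tendsto_of_primitive hg hu ht₀
  have hbd : ∀ᶠ t in 𝓝[Icc 0 T] t₀,
      (Integrable (fun x => |u t x| ^ r₁) (volume.restrict S.U) ∧
        ∫ x in S.U, |u t x| ^ r₁ ≤ C) ∧
      Integrable (fun x => |v t x| ^ r₂) (volume.restrict S.U) ∧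
        ∫ x in S.U, |v t x| ^ r₂ ≤ C := by
    filter_upwards [self_mem_nhdsWithin] with t ht using ⟨hub t ht, hvb t ht⟩
  -- The source term tested with `u t` (`hB`) converges to its value at `t₀`; tested with `u t₀ - u
  -- t` (`hD`) it tends to zero.
  have hB := tendsto_integral_logPow (A := 0) (B := 1) hσ hr₁ hr₂ hgap hut hv hbd
    (hub t₀ ht₀).1 (by simp) (by simp)
  have hD := tendsto_integral_logPow (A := 1) (B := -1) hσ hr₁ hr₂ hgap hut hv hbd
    (hub t₀ ht₀).1 (by simp) (by simp)
  simp only [zero_mul, one_mul, zero_add, neg_mul, ← sub_eq_add_neg, sub_self, mul_zero,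
    integral_zero] at hB hD
  set b : ℝ → ℝ := fun t => ∫ x in S.U, logPow S.σ (u t x * v t x) * v t x * u t x with hb
  set e : ℝ → ℝ := fun t =>
    ∫ x in S.U, logPow S.σ (u t x * v t x) * v t x * (u t₀ x - u t x) with he
  set z : ℝ → ℝ := fun t => S.bracket r (u t) with hz
  have hGz : ∀ t, gagliardo S.U S.s r (u t) = r * z t := fun t => by
    simp only [hz, System.bracket]; field_simp
  have hznn : ∀ t, 0 ≤ z t := fun t =>
    mul_nonneg (by positivity) (gagliardo_nonneg _ _)
  refine _root_.hasDerivWithinAt_half_norm_sq hg hu ht₀ fun ε hε => ?_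
  obtain ⟨D, hD0, η, hη, hDη⟩ := abs_sub_le_of_monotoneOn hKc hKm hKnn (hznn t₀)
    (ε := ε / (4 * r)) (by positivity)
  have hlsc := eventually_lt_gagliardo (s := S.s) hr0 hut
    (by filter_upwards [self_mem_nhdsWithin] with t ht using (hW t ht).integrableOn hU)
    ((hW t₀ ht₀).integrableOn hU) (ε := r * η) (by positivity)
  have hBε : ∀ᶠ t in 𝓝[Icc 0 T] t₀, |b t - b t₀| < ε / 4 :=
    hB.eventually (Metric.ball_mem_nhds _ (by positivity))
  have hDε : ∀ᶠ t in 𝓝[Icc 0 T] t₀, |e t - 0| < ε / (4 * r * D) :=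
    hD.eventually (Metric.ball_mem_nhds _ (by positivity))
  obtain ⟨δ, hδ, hδb⟩ := Metric.mem_nhdsWithin_iff.1 (hlsc.and (hBε.and hDε))
  refine ⟨r * D, δ, hδ, ?_⟩
  filter_upwards [heq] with τ hτ hτT hτδ
  have hτI : τ ∈ Icc 0 T := ⟨hτT.1.le, hτT.2⟩
  obtain ⟨h1, h2, h3⟩ := hδb ⟨hτδ, hτI⟩
  have hcoe : (↑(u t₀ - u τ) : Space N → ℝ) =ᵐ[volume.restrict S.U] ⇑(u t₀) - ⇑(u τ) :=
    Lp.coeFn_sub _ _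
  have hself := hτ hτT (u τ) (hW τ hτI)
  rw [S.fracLaplacePairing_self hr, hGz] at hself
  have hdiff := hτ hτT (u t₀ - u τ) (((hW t₀ ht₀).sub hr0 (hW τ hτI)).congr_ae hU hcoe.symm)
  have hpair := S.fracLaplacePairing_sub_le hr (Lp.aestronglyMeasurable _)
    (Lp.aestronglyMeasurable _) ((hW τ hτI).integrableOn hU) ((hW t₀ ht₀).integrableOn hU) hcoe
  have hint : ∫ x in S.U, logPow S.σ (u τ x * v τ x) * v τ x * (u t₀ - u τ : L2 S.U) x = e τ := by
    refine integral_congr_ae ?_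
    filter_upwards [hcoe] with x hx
    rw [hx]; rfl
  rw [hint] at hdiff
  have hKτ := hKnn (z τ) (hznn τ)
  have hcs := abs_real_inner_le_norm (g τ) (u t₀ - u τ)
  rw [norm_sub_rev] at hcs
  have hlow : z t₀ - η < z τ := by
    rw [hGz, hGz] at h1
    have : r * (z t₀ - η) < r * z τ := by linarith
    exact lt_of_mul_lt_mul_left this hr0.le
  -- The upper half of the control: the equation tested with `u t₀ - u τ`, combined with convexity.
  -- The lower half `hlow` is lower semicontinuity.
  have hup : S.K (z τ) * (z τ - z t₀) ≤ |e τ| + ‖g τ‖ * ‖u τ - u t₀‖ := by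
    have h4 : S.K (z τ) * S.fracLaplacePairing r (u τ) (u t₀ - u τ : L2 S.U)
        ≤ S.K (z τ) * (z t₀ - z τ) := mul_le_mul_of_nonneg_left hpair hKτ
    have h5 := (abs_le.1 hcs).2
    have h6 := neg_abs_le (e τ)
    simp only [hz] at h4 hdiff ⊢
    linarith
  have hfin := hDη (z τ) (|e τ| + ‖g τ‖ * ‖u τ - u t₀‖) (hznn τ) (by positivity) hlow hup
  rw [hGz]
  have h7 : inner ℝ (g τ) (u τ) - (b t₀ - S.K (z t₀) * (r * z t₀))
      = (b τ - b t₀) - r * (S.K (z τ) * z τ - S.K (z t₀) * z t₀) := by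
    simp only [hz, hb] at hself ⊢
    linarith
  have h8 : D * |e τ| * r ≤ ε / 4 := by
    rw [sub_zero, lt_div_iff₀ (by positivity)] at h3
    linarith
  have h9 : r * (ε / (4 * r)) = ε / 4 := by field_simp
  calc |inner ℝ (g τ) (u τ) - (b t₀ - S.K (z t₀) * (r * z t₀))|
      ≤ |b τ - b t₀| + |r * (S.K (z τ) * z τ - S.K (z t₀) * z t₀)| := by
        rw [h7]; exact abs_sub _ _
    _ ≤ ε / 4 + r * (ε / (4 * r) + D * (|e τ| + ‖g τ‖ * ‖u τ - u t₀‖)) := by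
        rw [abs_mul, abs_of_pos hr0]; gcongr
    _ ≤ ε + r * D * (‖g τ‖ * ‖u τ - u t₀‖) := by
        rw [mul_add, h9]; linarith

end Derivative

end FracKirchhoff

/-! ### The potential well -/

namespace FracKirchhoff

section PotentialWell

variable {N : ℕ} {S : System N}

theorem System.H1.monotoneOn_Ici (h : S.H1) (hK : S.IsKirchhoff) : MonotoneOn S.K (Ici 0) := by
  intro x hx y hy hxy
  rcases (mem_Ici.1 hx).eq_or_lt with rfl | hx0
  · rcases hxy.eq_or_lt with rfl | hy0
    · exact le_rfl
    have hlim := (hK.1 0 hx).mono_left (nhdsWithin_mono 0 Ioi_subset_Ici_self)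
    refine le_of_tendsto hlim ?_
    filter_upwards [Ioo_mem_nhdsGT hy0] with t ht using h ht.1 hy0 ht.2.le
  · exact h hx0 (hx0.trans_le hxy) hxy

theorem System.IsKirchhoff.nonneg (hK : S.IsKirchhoff) {z : ℝ} (hz : 0 ≤ z) : 0 ≤ S.K z := by
  have hc : ContinuousOn S.K (closure (Ioi 0)) := by rw [closure_Ioi]; exact hK.1
  have hmem : z ∈ closure (Ioi (0 : ℝ)) := by rw [closure_Ioi]; exact hz
  have := hc.image_closure (mem_image_of_mem _ hmem)
  refine closure_minimal ?_ isClosed_Ici this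
  rintro _ ⟨y, hy, rfl⟩
  exact (hK.2 y hy).le

theorem System.IsKirchhoff.intervalIntegrable (hK : S.IsKirchhoff) {z : ℝ} (hz : 0 ≤ z) :
    IntervalIntegrable S.K volume 0 z :=
  (hK.1.mono Icc_subset_Ici_self).intervalIntegrable_of_Icc hz

theorem System.Khat_le (hK : S.IsKirchhoff) (h1 : S.H1) {z : ℝ} (hz : 0 ≤ z) :
    S.Khat z ≤ S.K z * z := by
  calc S.Khat z ≤ ∫ _ in (0 : ℝ)..z, S.K z :=
        intervalIntegral.integral_mono_on hz (hK.intervalIntegrable hz) (by simp)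
          fun t ht => h1.monotoneOn_Ici hK ht.1 hz ht.2
    _ = _ := by simp [mul_comm]

/-- H2 gives `K t ≥ K z (t / z)^β` for `0 < t < z`; integrate in `t`. -/
theorem System.le_Khat (hK : S.IsKirchhoff) (h2 : S.H2) (hβ : 0 ≤ S.β) {z : ℝ} (hz : 0 ≤ z) :
    S.K z * z / (S.β + 1) ≤ S.Khat z := by
  rcases hz.eq_or_lt with rfl | hz0
  · simp [System.Khat]
  have hint : ∫ t in (0 : ℝ)..z, S.K z / z ^ S.β * t ^ S.β = S.K z * z / (S.β + 1) := by
    rw [intervalIntegral.integral_const_mul, integral_rpow (Or.inl (by linarith)),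
      Real.zero_rpow (by linarith), Real.rpow_add hz0, Real.rpow_one]
    have : z ^ S.β ≠ 0 := (Real.rpow_pos_of_pos hz0 _).ne'
    field_simp
    ring
  rw [← hint]
  refine intervalIntegral.integral_mono_on_of_le_Ioo hz ?_ (hK.intervalIntegrable hz) fun t ht => ?_
  · exact (intervalIntegral.intervalIntegrable_rpow (Or.inl hβ)).const_mul _
  · have := h2 (mem_Ioi.2 ht.1) (mem_Ioi.2 hz0) ht.2.le
    exact (le_div_iff₀ (Real.rpow_pos_of_pos ht.1 _)).1 this

theorem System.gagliardo_eq_mul_bracket {r : ℝ} (hr : r ≠ 0) (w : Space N → ℝ) :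
    gagliardo S.U S.s r w = r * S.bracket r w := by
  rw [System.bracket]; field_simp

theorem System.bracket_nonneg {r : ℝ} (hr : 0 < r) (w : Space N → ℝ) : 0 ≤ S.bracket r w :=
  mul_nonneg (by positivity) (gagliardo_nonneg _ _)

/-- The Kirchhoff part of the Nehari functional. -/
noncomputable def System.stiffness (S : System N) (u v : Space N → ℝ) : ℝ :=
  S.K (S.bracket S.p u) * gagliardo S.U S.s S.p u
    + S.K (S.bracket S.q v) * gagliardo S.U S.s S.q v

/-- The integral `∫ |u|^σ |v|^σ` over the domain. -/
noncomputable def System.powInt (S : System N) (u v : Space N → ℝ) : ℝ :=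
  ∫ x in S.U, |u x| ^ S.σ * |v x| ^ S.σ

/-- The integral `∫ |u|^σ |v|^σ log |u v|` over the domain. -/
noncomputable def System.logInt (S : System N) (u v : Space N → ℝ) : ℝ :=
  ∫ x in S.U, |u x| ^ S.σ * |v x| ^ S.σ * Real.log |u x * v x|

theorem System.nehari_eq (u v : Space N → ℝ) :
    S.nehari u v = S.stiffness u v - 2 * S.logInt u v := rfl

theorem System.powInt_nonneg (u v : Space N → ℝ) : 0 ≤ S.powInt u v :=
  integral_nonneg fun x => by positivity

theorem System.stiffness_nonneg (hK : S.IsKirchhoff) (hp : 0 < S.p) (hq : 0 < S.q)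
    (u v : Space N → ℝ) : 0 ≤ S.stiffness u v :=
  add_nonneg (mul_nonneg (hK.nonneg (System.bracket_nonneg hp u)) (gagliardo_nonneg _ _))
    (mul_nonneg (hK.nonneg (System.bracket_nonneg hq v)) (gagliardo_nonneg _ _))

theorem System.energy_ge (hK : S.IsKirchhoff) (h2 : S.H2) (hβ : 0 ≤ S.β) (hp : 0 < S.p)
    (hpq : S.p ≤ S.q) (u v : Space N → ℝ) :
    S.stiffness u v / (S.q * (S.β + 1)) + 1 / S.σ ^ 2 * S.powInt u v - 1 / S.σ * S.logInt u v
      ≤ S.energy u v := by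
  have hq : 0 < S.q := hp.trans_le hpq
  have hzu := System.bracket_nonneg (S := S) hp u
  have hzv := System.bracket_nonneg (S := S) hq v
  have hu := System.le_Khat hK h2 hβ hzu
  have hv := System.le_Khat hK h2 hβ hzv
  have hle : S.stiffness u v / (S.q * (S.β + 1))
      ≤ S.Khat (S.bracket S.p u) + S.Khat (S.bracket S.q v) := by
    rw [System.stiffness, System.gagliardo_eq_mul_bracket hp.ne',
      System.gagliardo_eq_mul_bracket hq.ne', add_div]
    refine add_le_add (le_trans ?_ hu) (le_trans (le_of_eq ?_) hv)
    · have := mul_nonneg (hK.nonneg hzu) hzu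
      rw [div_le_div_iff₀ (by positivity) (by positivity)]
      have : S.K (S.bracket S.p u) * S.bracket S.p u * (S.β + 1) * S.p
          ≤ S.K (S.bracket S.p u) * S.bracket S.p u * (S.β + 1) * S.q := by gcongr
      linarith
    · field_simp
  simp only [System.energy]
  simp only [System.powInt, System.logInt] at *
  linarith

theorem System.energy_le (hK : S.IsKirchhoff) (h1 : S.H1) (hp : 0 < S.p)
    (hpq : S.p ≤ S.q) (u v : Space N → ℝ) :
    S.energy u v
      ≤ S.stiffness u v / S.p + 1 / S.σ ^ 2 * S.powInt u v - 1 / S.σ * S.logInt u v := by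
  have hq : 0 < S.q := hp.trans_le hpq
  have hzu := System.bracket_nonneg (S := S) hp u
  have hzv := System.bracket_nonneg (S := S) hq v
  have hu := System.Khat_le hK h1 hzu
  have hv := System.Khat_le hK h1 hzv
  have hle : S.Khat (S.bracket S.p u) + S.Khat (S.bracket S.q v) ≤ S.stiffness u v / S.p := by
    rw [System.stiffness, System.gagliardo_eq_mul_bracket hp.ne',
      System.gagliardo_eq_mul_bracket hq.ne', add_div]
    refine add_le_add (hu.trans (le_of_eq ?_)) (hv.trans ?_)
    · field_simp
    · have := mul_nonneg (hK.nonneg hzv) hzv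
      rw [le_div_iff₀ hp]
      have : S.K (S.bracket S.q v) * S.bracket S.q v * S.p
          ≤ S.K (S.bracket S.q v) * S.bracket S.q v * S.q := by gcongr
      linarith
  simp only [System.energy]
  simp only [System.powInt, System.logInt] at *
  linarith

theorem System.integral_congr_ae_pair {u v u' v' : Space N → ℝ}
    (hu : u =ᵐ[volume.restrict S.U] u') (hv : v =ᵐ[volume.restrict S.U] v') :
    S.powInt u v = S.powInt u' v' ∧ S.logInt u v = S.logInt u' v' := by
  constructor <;> refine integral_congr_ae ?_ <;> filter_upwards [hu, hv] with x h1 h2 <;>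
    rw [h1, h2]

theorem System.energy_congr_ae {u v u' v' : Space N → ℝ}
    (hu : u =ᵐ[volume.restrict S.U] u') (hv : v =ᵐ[volume.restrict S.U] v') :
    S.energy u v = S.energy u' v' := by
  obtain ⟨h1, h2⟩ := System.integral_congr_ae_pair hu hv
  simp only [System.powInt, System.logInt] at h1 h2
  rw [System.energy, System.energy, System.bracket, System.bracket, System.bracket,
    System.bracket, gagliardo_congr_ae hu, gagliardo_congr_ae hv, h1, h2]

theorem System.nehari_congr_ae {u v u' v' : Space N → ℝ}
    (hu : u =ᵐ[volume.restrict S.U] u') (hv : v =ᵐ[volume.restrict S.U] v') :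
    S.nehari u v = S.nehari u' v' := by
  obtain ⟨h1, h2⟩ := System.integral_congr_ae_pair hu hv
  rw [System.nehari_eq, System.nehari_eq, h2, System.stiffness, System.stiffness,
    System.bracket, System.bracket, System.bracket,
    System.bracket, gagliardo_congr_ae hu, gagliardo_congr_ae hv]

/-- A nonzero Bochner integral forces integrability of its integrand. The logarithm is at least `1`
where `|u v| ≥ e`, and elsewhere the power is bounded on a set of finite measure. -/
theorem System.integrableOn_of_logInt_ne_zero (hUfin : volume S.U ≠ ⊤) (hσ : 0 < S.σ)
    {u v : Space N → ℝ}
    (hu : AEStronglyMeasurable u (volume.restrict S.U))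
    (hv : AEStronglyMeasurable v (volume.restrict S.U)) (h : S.logInt u v ≠ 0) :
    IntegrableOn (fun x => |u x| ^ S.σ * |v x| ^ S.σ * Real.log |u x * v x|) S.U ∧
      IntegrableOn (fun x => |u x| ^ S.σ * |v x| ^ S.σ) S.U := by
  have hlog : IntegrableOn (fun x => |u x| ^ S.σ * |v x| ^ S.σ * Real.log |u x * v x|) S.U := by
    by_contra hcon
    exact h (integral_undef hcon)
  have : IsFiniteMeasure (volume.restrict S.U) := ⟨by simpa using hUfin.lt_top⟩
  refine ⟨hlog, ((integrable_const (Real.exp 1 ^ S.σ)).add hlog.norm).mono'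
    ((hu.norm.aemeasurable.pow_const S.σ).mul
      (hv.norm.aemeasurable.pow_const S.σ)).aestronglyMeasurable (ae_of_all _ fun x => ?_)⟩
  simp only [Pi.add_apply]
  rw [← Real.mul_rpow (abs_nonneg _) (abs_nonneg _), ← abs_mul]
  set y := |u x * v x| with hy
  have hy0 : 0 ≤ y := abs_nonneg _
  have hyσ : 0 ≤ y ^ S.σ := by positivity
  rw [Real.norm_eq_abs, Real.norm_eq_abs, abs_mul, abs_of_nonneg hyσ]
  rcases le_total y (Real.exp 1) with h1 | h1
  · have h2 : y ^ S.σ ≤ Real.exp 1 ^ S.σ := by gcongr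
    have h3 : 0 ≤ y ^ S.σ * |Real.log y| := by positivity
    linarith
  · have h2 : 1 ≤ Real.log y := by
      rw [Real.le_log_iff_exp_le ((Real.exp_pos 1).trans_le h1)]; exact h1
    have h3 : 0 ≤ Real.exp 1 ^ S.σ := by positivity
    have h4 : y ^ S.σ * 1 ≤ y ^ S.σ * |Real.log y| :=
      mul_le_mul_of_nonneg_left (h2.trans (le_abs_self _)) hyσ
    linarith

theorem System.powInt_pos_of_logInt_ne_zero {u v : Space N → ℝ}
    (hi : IntegrableOn (fun x => |u x| ^ S.σ * |v x| ^ S.σ) S.U) (h : S.logInt u v ≠ 0) :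
    0 < S.powInt u v := by
  refine lt_of_le_of_ne (System.powInt_nonneg u v) fun h0 => h ?_
  have h1 := (integral_eq_zero_iff_of_nonneg (fun x => by positivity) hi).1 h0.symm
  rw [System.logInt, integral_congr_ae (g := fun _ => 0), integral_zero]
  filter_upwards [h1] with x hx
  simp only [Pi.zero_apply] at hx
  rw [hx, zero_mul]

theorem System.powInt_smul (u v : Space N → ℝ) {l : ℝ} (hl : 0 < l) :
    S.powInt (l • u) (l • v) = l ^ S.σ * l ^ S.σ * S.powInt u v := by
  simp only [System.powInt, ← integral_const_mul]
  refine integral_congr_ae (ae_of_all _ fun x => ?_)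
  simp only [Pi.smul_apply, smul_eq_mul, abs_mul, abs_of_pos hl,
    Real.mul_rpow hl.le (abs_nonneg _)]
  ring

theorem System.logInt_smul (hσ : 0 < S.σ) {u v : Space N → ℝ} {l : ℝ} (hl : 0 < l)
    (h1 : IntegrableOn (fun x => |u x| ^ S.σ * |v x| ^ S.σ * Real.log |u x * v x|) S.U)
    (h2 : IntegrableOn (fun x => |u x| ^ S.σ * |v x| ^ S.σ) S.U) :
    S.logInt (l • u) (l • v)
      = l ^ S.σ * l ^ S.σ * (S.logInt u v + 2 * Real.log l * S.powInt u v) := by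
  rw [System.logInt, System.logInt, System.powInt, ← integral_const_mul,
    ← integral_add h1 (h2.const_mul _), ← integral_const_mul]
  refine integral_congr_ae (ae_of_all _ fun x => ?_)
  simp only [Pi.smul_apply, smul_eq_mul, abs_mul, abs_of_pos hl,
    Real.mul_rpow hl.le (abs_nonneg _)]
  -- At zeros of `u` or `v` the logarithm of the product does not split (`Real.log 0 = 0`), but the
  -- prefactor vanishes.
  rcases eq_or_ne (u x) 0 with h | h
  · simp [h, Real.zero_rpow hσ.ne']
  rcases eq_or_ne (v x) 0 with h' | h'
  · simp [h', Real.zero_rpow hσ.ne']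
  rw [show l * |u x| * (l * |v x|) = (l * l) * (|u x| * |v x|) by ring,
    Real.log_mul (x := l * l) (by positivity) (by positivity), Real.log_mul hl.ne' hl.ne']
  ring

theorem System.bracket_smul (r : ℝ) (u : Space N → ℝ) {l : ℝ} (hl : 0 < l) :
    S.bracket r (l • u) = l ^ r * S.bracket r u := by
  rw [System.bracket, System.bracket, gagliardo_const_smul, abs_of_pos hl]; ring

theorem System.stiffness_smul_le (hK : S.IsKirchhoff) (h1 : S.H1) (hp : 0 < S.p) (hq : 0 < S.q)
    (u v : Space N → ℝ) {l : ℝ} (hl : 0 < l) (hl1 : l ≤ 1) :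
    S.stiffness (l • u) (l • v) ≤ S.stiffness u v := by
  have key : ∀ r : ℝ, 0 < r → ∀ w : Space N → ℝ,
      S.K (S.bracket r (l • w)) * gagliardo S.U S.s r (l • w)
        ≤ S.K (S.bracket r w) * gagliardo S.U S.s r w := by
    intro r hr w
    have hz := System.bracket_nonneg (S := S) hr w
    have hlr : l ^ r ≤ 1 := Real.rpow_le_one hl.le hl1 hr.le
    have hG := gagliardo_nonneg (s := S.s) (p := r) S.U w
    rw [System.bracket_smul r w hl, gagliardo_const_smul, abs_of_pos hl]
    have hlz : 0 ≤ l ^ r * S.bracket r w := by positivity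
    refine mul_le_mul (h1.monotoneOn_Ici hK hlz hz ?_) ?_ (by positivity) (hK.nonneg hz)
    · exact mul_le_of_le_one_left hz hlr
    · exact mul_le_of_le_one_left hG hlr
  exact add_le_add (key _ hp u) (key _ hq v)

/-- A pair with negative Nehari functional can be scaled down onto the Nehari manifold. -/
theorem System.exists_smul_nehari_eq_zero (hUfin : volume S.U ≠ ⊤) (hσ : 0 < S.σ)
    (hK : S.IsKirchhoff) (hp : 0 < S.p) (hq : 0 < S.q) {u v : Space N → ℝ}
    (hu : AEStronglyMeasurable u (volume.restrict S.U))
    (hv : AEStronglyMeasurable v (volume.restrict S.U)) (h : S.nehari u v < 0) :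
    ∃ l : ℝ, 0 < l ∧ l ≤ 1 ∧ S.nehari (l • u) (l • v) = 0 := by
  have hE := System.stiffness_nonneg hK hp hq u v
  have hB : 0 < S.logInt u v := by rw [System.nehari_eq] at h; linarith
  obtain ⟨hi1, hi2⟩ := System.integrableOn_of_logInt_ne_zero hUfin hσ hu hv hB.ne'
  have hA := System.powInt_pos_of_logInt_ne_zero hi2 hB.ne'
  set A := S.powInt u v
  set B := S.logInt u v
  -- The scale at which the logarithmic integral vanishes, so `ψ ≥ 0` there; `ψ < 0` at scale `1`,
  -- and the intermediate value theorem applies in between.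
  set l₀ := Real.exp (-(B / (2 * A))) with hl₀
  have hl₀pos : 0 < l₀ := Real.exp_pos _
  have hl₀1 : l₀ ≤ 1 := Real.exp_le_one_iff.2 (by
    have : 0 < B / (2 * A) := by positivity
    linarith)
  have hform : ∀ l ∈ Icc l₀ 1, S.nehari (l • u) (l • v)
      = S.K (l ^ S.p * S.bracket S.p u) * (l ^ S.p * gagliardo S.U S.s S.p u)
        + S.K (l ^ S.q * S.bracket S.q v) * (l ^ S.q * gagliardo S.U S.s S.q v)
        - 2 * (l ^ S.σ * l ^ S.σ * (B + 2 * Real.log l * A)) := by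
    intro l hl
    have hlpos : 0 < l := hl₀pos.trans_le hl.1
    rw [System.nehari_eq, System.stiffness, System.logInt_smul hσ hlpos hi1 hi2,
      System.bracket_smul _ _ hlpos, System.bracket_smul _ _ hlpos, gagliardo_const_smul,
      gagliardo_const_smul, abs_of_pos hlpos]
  have hcont : ContinuousOn (fun l : ℝ => S.nehari (l • u) (l • v)) (Icc l₀ 1) := by
    refine ContinuousOn.congr ?_ hform
    have hpow : ∀ r : ℝ, ContinuousOn (fun l : ℝ => l ^ r) (Icc l₀ 1) := fun r l hl =>
      (Real.continuousAt_rpow_const l r (Or.inl (hl₀pos.trans_le hl.1).ne')).continuousWithinAt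
    have hlog : ContinuousOn Real.log (Icc l₀ 1) := fun l hl =>
      (Real.continuousAt_log (hl₀pos.trans_le hl.1).ne').continuousWithinAt
    have hKc : ∀ r : ℝ, 0 < r → ∀ w : Space N → ℝ,
        ContinuousOn (fun l : ℝ => S.K (l ^ r * S.bracket r w)) (Icc l₀ 1) := fun r hr w =>
      hK.1.comp ((hpow r).mul continuousOn_const) fun l hl =>
        mul_nonneg (Real.rpow_nonneg (hl₀pos.trans_le hl.1).le _) (System.bracket_nonneg hr w)
    exact (((hKc _ hp u).mul ((hpow _).mul continuousOn_const)).add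
      ((hKc _ hq v).mul ((hpow _).mul continuousOn_const))).sub
      (continuousOn_const.mul (((hpow _).mul (hpow _)).mul
        (continuousOn_const.add ((continuousOn_const.mul hlog).mul continuousOn_const))))
  have h0 : 0 ≤ S.nehari (l₀ • u) (l₀ • v) := by
    rw [System.nehari_eq, System.logInt_smul hσ hl₀pos hi1 hi2, hl₀, Real.log_exp]
    have : B + 2 * -(B / (2 * A)) * A = 0 := by field_simp; ring
    rw [this, mul_zero, mul_zero, sub_zero]
    exact System.stiffness_nonneg hK hp hq _ _
  have h1 : S.nehari ((1 : ℝ) • u) ((1 : ℝ) • v) ≤ 0 := by rw [one_smul, one_smul]; exact h.le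
  obtain ⟨l, hl, hl0⟩ := intermediate_value_Icc' hl₀1 hcont ⟨h1, h0⟩
  exact ⟨l, hl₀pos.trans_le hl.1, hl.2, hl0⟩

theorem System.bddBelow_energy_nehariManifold (hK : S.IsKirchhoff) (h2 : S.H2) (hβ : 0 ≤ S.β)
    (hp : 0 < S.p) (hpq : S.p ≤ S.q) (hσ : S.q * (S.β + 1) < S.σ) :
    BddBelow ((fun w : L2 S.U × L2 S.U => S.energy w.1 w.2) '' S.nehariManifold) := by
  refine ⟨0, ?_⟩
  rintro _ ⟨w, ⟨-, -, hw⟩, rfl⟩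
  have hq : 0 < S.q := hp.trans_le hpq
  have hQ : 0 < S.q * (S.β + 1) := by positivity
  have hE := System.stiffness_nonneg hK hp hq w.1 w.2
  have hA := System.powInt_nonneg (S := S) w.1 w.2
  have hen := System.energy_ge hK h2 hβ hp hpq w.1 w.2
  have hσpos : 0 < S.σ := hQ.trans hσ
  rw [System.nehari_eq] at hw
  have h1 : S.stiffness w.1 w.2 / S.σ ≤ S.stiffness w.1 w.2 / (S.q * (S.β + 1)) := by gcongr
  have h3 : 1 / S.σ * S.logInt w.1 w.2 = S.stiffness w.1 w.2 / S.σ / 2 := by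
    have : S.logInt w.1 w.2 = S.stiffness w.1 w.2 / 2 := by linarith
    rw [this]; ring
  have h4 : 0 ≤ S.stiffness w.1 w.2 / S.σ := by positivity
  have h5 : 0 ≤ 1 / S.σ ^ 2 * S.powInt w.1 w.2 := by positivity
  simp only at *
  linarith

/-- The scaled pair on the Nehari manifold competes in the infimum. There the logarithmic term
equals half the stiffness, and what remains of the upper energy bound only grows when the scale `l ≤
1` is undone. -/
theorem System.depth_le (hUfin : volume S.U ≠ ⊤) (hUm : MeasurableSet S.U) (hK : S.IsKirchhoff)
    (h1 : S.H1) (h2 : S.H2) (hβ : 0 ≤ S.β) (hp : 0 < S.p) (hpq : S.p ≤ S.q)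
    (hσ : S.q * (S.β + 1) < S.σ) {w : L2 S.U × L2 S.U} (hw : w ∈ S.phaseSpace)
    (hneg : S.nehari w.1 w.2 < 0) :
    S.depth ≤ (1 / S.p - 1 / (2 * S.σ)) * S.stiffness w.1 w.2
      + 1 / S.σ ^ 2 * S.powInt w.1 w.2 := by
  have hq : 0 < S.q := hp.trans_le hpq
  have hQ : S.q ≤ S.q * (S.β + 1) := le_mul_of_one_le_right hq.le (by linarith)
  have hσpos : 0 < S.σ := by linarith
  obtain ⟨l, hl, hl1, hl0⟩ := System.exists_smul_nehari_eq_zero hUfin hσpos hK hp hq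
    (Lp.aestronglyMeasurable w.1) (Lp.aestronglyMeasurable w.2) hneg
  have hc1 : ⇑(l • w).1 =ᵐ[volume.restrict S.U] l • ⇑w.1 := Lp.coeFn_smul l w.1
  have hc2 : ⇑(l • w).2 =ᵐ[volume.restrict S.U] l • ⇑w.2 := Lp.coeFn_smul l w.2
  have hmem : l • w ∈ S.nehariManifold := by
    refine ⟨⟨(hw.1.const_smul l).congr_ae hUm hc1.symm, (hw.2.const_smul l).congr_ae hUm hc2.symm⟩,
      fun h0 => ?_, ?_⟩
    · rw [smul_eq_zero, or_iff_right hl.ne'] at h0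
      have hlog0 : S.logInt w.1 w.2 = 0 := by
        rw [System.logInt, integral_congr_ae (g := fun _ => 0), integral_zero]
        filter_upwards [show (⇑w.1) =ᵐ[volume.restrict S.U] 0 by
          rw [h0]; exact Lp.coeFn_zero ℝ 2 _] with x hx
        simp [hx, Real.zero_rpow hσpos.ne']
      have := System.stiffness_nonneg hK hp hq w.1 w.2
      rw [System.nehari_eq, hlog0] at hneg
      linarith
    · rw [← hl0]
      exact System.nehari_congr_ae hc1 hc2
  have hd' : S.depth ≤ S.energy (l • w).1 (l • w).2 :=
    csInf_le (System.bddBelow_energy_nehariManifold hK h2 hβ hp hpq hσ) ⟨l • w, hmem, rfl⟩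
  have hd : S.depth ≤ S.energy (l • ⇑w.1) (l • ⇑w.2) :=
    hd'.trans_eq (System.energy_congr_ae hc1 hc2)
  have hen := System.energy_le hK h1 hp hpq (l • ⇑w.1) (l • ⇑w.2)
  have hEl := System.stiffness_smul_le hK h1 hp hq w.1 w.2 hl hl1
  rw [System.nehari_eq] at hl0
  have hB : S.logInt (l • ⇑w.1) (l • ⇑w.2) = S.stiffness (l • ⇑w.1) (l • ⇑w.2) / 2 := by linarith
  have hA : S.powInt (l • ⇑w.1) (l • ⇑w.2) ≤ S.powInt w.1 w.2 := by
    rw [System.powInt_smul _ _ hl]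
    have h3 : l ^ S.σ ≤ 1 := Real.rpow_le_one hl.le hl1 hσpos.le
    have h4 : l ^ S.σ * l ^ S.σ ≤ 1 := mul_le_one₀ h3 (by positivity) h3
    exact mul_le_of_le_one_left (System.powInt_nonneg _ _) h4
  have hcoef : 0 ≤ 1 / S.p - 1 / (2 * S.σ) := by
    rw [sub_nonneg]
    exact one_div_le_one_div_of_le hp (by linarith)
  calc S.depth ≤ S.stiffness (l • ⇑w.1) (l • ⇑w.2) / S.p
        + 1 / S.σ ^ 2 * S.powInt (l • ⇑w.1) (l • ⇑w.2)
        - 1 / S.σ * S.logInt (l • ⇑w.1) (l • ⇑w.2) := hd.trans hen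
    _ = (1 / S.p - 1 / (2 * S.σ)) * S.stiffness (l • ⇑w.1) (l • ⇑w.2)
        + 1 / S.σ ^ 2 * S.powInt (l • ⇑w.1) (l • ⇑w.2) := by
        rw [hB]; field_simp; ring
    _ ≤ _ := by gcongr

/-- The factor `κ` in `d_*` turns the coefficient `1/p - 1/σ` of the upper bound for `d` into the
coefficient `1/Q - 1/σ` of the energy bound. The excess `κ E / 2` is absorbed by `B ≥ E / 2`,
because `κ ≤ 1`; the `A₀` term has a favourable sign. -/
theorem mul_depthStar_le {p Q σ E A A₀ B d Φ : ℝ} (hp : 0 < p) (hpQ : p ≤ Q) (hQσ : Q < σ)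
    (hA : 0 ≤ A) (hA₀ : 0 ≤ A₀) (hE : 0 ≤ E) (hB : E ≤ 2 * B)
    (hd : d ≤ (1 / p - 1 / (2 * σ)) * E + 1 / σ ^ 2 * A)
    (hΦ : E / Q + 1 / σ ^ 2 * A - 1 / σ * B ≤ Φ) :
    σ * ((d - 1 / σ * A₀) * (1 / Q - 1 / σ) / (1 / p - 1 / σ)) ≤ σ * Φ - (E - 2 * B) := by
  have hQ : 0 < Q := hp.trans_le hpQ
  have hσ : 0 < σ := hQ.trans hQσ
  have h1 : 0 < 1 / Q - 1 / σ := sub_pos.2 (one_div_lt_one_div_of_lt hQ hQσ)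
  have h2 : 1 / Q - 1 / σ ≤ 1 / p - 1 / σ := by
    have := one_div_le_one_div_of_le hp hpQ
    linarith
  set κ := (1 / Q - 1 / σ) / (1 / p - 1 / σ) with hκ
  have h3 : 0 < 1 / p - 1 / σ := h1.trans_le h2
  have hκ0 : 0 ≤ κ := by positivity
  have hκ1 : κ ≤ 1 := (div_le_one h3).2 h2
  have hκm : κ * (1 / p - 1 / σ) = 1 / Q - 1 / σ := div_mul_cancel₀ _ h3.ne'
  have hA₀' : 0 ≤ 1 / σ * A₀ := by positivity
  have hsd : σ * ((d - 1 / σ * A₀) * κ)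
      ≤ σ * (((1 / p - 1 / (2 * σ)) * E + 1 / σ ^ 2 * A) * κ) := by
    gcongr; linarith
  have hexp : σ * (((1 / p - 1 / (2 * σ)) * E + 1 / σ ^ 2 * A) * κ)
      = (σ * (κ * (1 / p - 1 / σ)) + κ / 2) * E + κ * (A / σ) := by field_simp; ring
  have hκE : κ * E ≤ 1 * E := by gcongr
  have hκA : κ * (A / σ) ≤ 1 * (A / σ) := by gcongr
  have hΦσ : σ * (E / Q + 1 / σ ^ 2 * A - 1 / σ * B) ≤ σ * Φ := by gcongr
  have hexp2 : σ * (E / Q + 1 / σ ^ 2 * A - 1 / σ * B) = σ * (1 / Q) * E + A / σ - B := by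
    field_simp
  have hexp3 : (σ * (1 / Q - 1 / σ) + κ / 2) * E = σ * (1 / Q) * E - E + κ * E / 2 := by
    field_simp
  rw [mul_div_assoc, ← hκ]
  rw [hκm, hexp3] at hexp
  linarith

theorem System.mul_depthStar_le (hUfin : volume S.U ≠ ⊤) (hUm : MeasurableSet S.U)
    (hK : S.IsKirchhoff) (h1 : S.H1) (h2 : S.H2) (hβ : 0 ≤ S.β) (hp : 0 < S.p) (hpq : S.p ≤ S.q)
    (hσ : S.q * (S.β + 1) < S.σ) (u₀ v₀ : Space N → ℝ) {w : L2 S.U × L2 S.U}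
    (hw : w ∈ S.phaseSpace) (hneg : S.nehari w.1 w.2 < 0) :
    S.σ * S.depthStar u₀ v₀ ≤ S.σ * S.energy w.1 w.2 - S.nehari w.1 w.2 := by
  have hq : 0 < S.q := hp.trans_le hpq
  have hQ : S.q ≤ S.q * (S.β + 1) := le_mul_of_one_le_right hq.le (by linarith)
  rw [System.nehari_eq] at hneg ⊢
  exact FracKirchhoff.mul_depthStar_le hp (hpq.trans hQ) hσ (System.powInt_nonneg _ _)
    (System.powInt_nonneg u₀ v₀) (System.stiffness_nonneg hK hp hq _ _) (by linarith)
    (System.depth_le hUfin hUm hK h1 h2 hβ hp hpq hσ hw hneg)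
    (System.energy_ge hK h2 hβ hp hpq _ _)

end PotentialWell

end FracKirchhoff

/-! ### Lifespan of weak solutions -/

namespace FracKirchhoff

section WeakSolution

open Filter Topology

variable {N : ℕ} {S : System N}

theorem two_mul_lt_criticalExponent {s p q σ : ℝ} (hN : 0 < N) (hs : 0 < s) (hp : 0 < p)
    (hpq : p < q) (h : ((2 * σ : ℝ) : EReal) ≤ criticalExponent N s p) :
    ((2 * σ : ℝ) : EReal) < criticalExponent N s q := by
  have hN' : (0 : ℝ) < N := by exact_mod_cast hN
  unfold criticalExponent at h ⊢
  split_ifs with hq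
  · have hsp : s * p < s * q := by gcongr
    rw [if_pos (hsp.trans hq), EReal.coe_le_coe_iff] at h
    rw [EReal.coe_lt_coe_iff]
    refine h.trans_lt ?_
    have h1 : 0 < (N : ℝ) - s * q := by linarith
    have h2 : 0 ≤ (N : ℝ) * q := mul_nonneg hN'.le (hp.trans hpq).le
    gcongr
  · exact EReal.coe_lt_top _

/-- Equality `2σ = p_s^*` is allowed, so `r₁` may have to lie below `2σ`. The critical exponent for
`q` is strictly above `2σ`, and choosing `r₂ > 2σ` compensates. -/
theorem exists_subcritical_exponents {s p q σ : ℝ} (hN : 0 < N) (hs : 0 < s) (hp : 0 < p)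
    (hpq : p < q) (hσ : 0 < σ) (h : ((2 * σ : ℝ) : EReal) ≤ criticalExponent N s p) :
    ∃ r₁ r₂ : ℝ, 0 < r₁ ∧ 0 < r₂ ∧ (r₁ : EReal) < criticalExponent N s p ∧
      (r₂ : EReal) < criticalExponent N s q ∧ (1 / r₁ + 1 / r₂) * σ < 1 := by
  obtain ⟨r₂, h₁, h₂⟩ :=
    EReal.lt_iff_exists_real_btwn.1 (two_mul_lt_criticalExponent hN hs hp hpq h)
  rw [EReal.coe_lt_coe_iff] at h₁
  have hr₂ : 0 < r₂ := by linarith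
  have h3 : σ / r₂ < 1 / 2 := by rw [div_lt_div_iff₀ hr₂ two_pos]; linarith
  have h4 : 0 < 1 - σ / r₂ := by linarith
  have h5 : σ / (1 - σ / r₂) < 2 * σ := by
    rw [div_lt_iff₀ h4]; nlinarith
  obtain ⟨r₁, h6, h7⟩ := exists_between h5
  have hr₁ : 0 < r₁ := (div_pos hσ h4).trans h6
  refine ⟨r₁, r₂, hr₁, hr₂, (EReal.coe_lt_coe_iff.2 h7).trans_le h, h₂, ?_⟩
  rw [div_lt_iff₀ h4] at h6
  have h8 : σ / r₁ < 1 - σ / r₂ := by rw [div_lt_iff₀ hr₁]; linarith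
  have h9 : (1 / r₁ + 1 / r₂) * σ = σ / r₁ + σ / r₂ := by ring
  linarith

theorem integral_abs_le_of_norm_le {U : Set (Space N)} (hUfin : volume U ≠ ⊤) {w : L2 U} {M : ℝ}
    (hM : ‖w‖ ≤ M) :
    IntegrableOn (fun x => |w x|) U ∧ ∫ x in U, |w x| ≤ volume.real U + M ^ 2 := by
  have : IsFiniteMeasure (volume.restrict U) := ⟨by simpa using hUfin.lt_top⟩
  have hL2 := Lp.memLp w
  have hi : IntegrableOn (fun x => |w x|) U := (hL2.integrable one_le_two).abs
  have hi2 : IntegrableOn (fun x => w x ^ 2) U := hL2.integrable_sq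
  have hsq : ∫ x in U, w x ^ 2 = ‖w‖ ^ 2 := by
    rw [← real_inner_self_eq_norm_sq, L2.inner_def]
    refine integral_congr_ae (ae_of_all _ fun x => ?_)
    simp [pow_two]
  refine ⟨hi, ?_⟩
  have hi3 : IntegrableOn (fun x => 1 + w x ^ 2) U :=
    (integrable_const (μ := volume.restrict U) (1 : ℝ)).add hi2
  calc ∫ x in U, |w x| ≤ ∫ x in U, (1 + w x ^ 2) :=
        setIntegral_mono hi hi3 fun x => by
          rw [← sq_abs]; nlinarith [sq_nonneg (|w x| - 1), abs_nonneg (w x)]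
    _ = volume.real U + ‖w‖ ^ 2 := by
        rw [integral_add (integrable_const 1) hi2, hsq]; simp
    _ ≤ _ := by gcongr

theorem gagliardo_univ_le_of_normW0_le {U : Set (Space N)} {s p M : ℝ} {w : Space N → ℝ}
    (hp : 0 < p) (h : normW0 U s p w ≤ M) :
    ∫ z, gagliardoKernel s p (U.indicator w) z ≤ M ^ p := by
  have h0 : 0 ≤ gagliardo univ s p (U.indicator w) := gagliardo_nonneg _ _
  have h1 : ∫ z, gagliardoKernel s p (U.indicator w) z = gagliardo univ s p (U.indicator w) := by
    rw [gagliardo, univ_prod_univ, setIntegral_univ]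
  rw [h1]
  calc _ = (gagliardo univ s p (U.indicator w) ^ (1 / p)) ^ p := by
        rw [← Real.rpow_mul h0, one_div_mul_cancel hp.ne', Real.rpow_one]
    _ ≤ _ := by
        have : 0 ≤ gagliardo univ s p (U.indicator w) ^ (1 / p) := by positivity
        gcongr
        exact h

/-- Continuity in `L²` on a compact time interval bounds the `L¹` norms, which start the bootstrap
at exponent `1`. -/
theorem exists_integral_rpow_le {U : Set (Space N)} {s p r M T : ℝ} (hN : 0 < N)
    (hUm : MeasurableSet U) (hUfin : volume U ≠ ⊤) (hs : 0 < s) (hp : 0 < p) (hr : 0 < r)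
    (hrc : (r : EReal) < criticalExponent N s p) {u : ℝ → L2 U} (huc : ContinuousOn u (Icc 0 T))
    (hW : ∀ t ∈ Icc 0 T, MemW0 U s p (u t)) (hM : ∀ t ∈ Icc 0 T, normW0 U s p (u t) ≤ M) :
    ∃ C, ∀ t ∈ Icc 0 T, IntegrableOn (fun x => |u t x| ^ r) U ∧ ∫ x in U, |u t x| ^ r ≤ C := by
  obtain ⟨D, hD⟩ := (isCompact_Icc.image_of_continuousOn huc).isBounded.exists_norm_le
  set F : Set (Space N → ℝ) := (fun t => U.indicator (u t)) '' Icc 0 T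
  have hpow : ∀ (m : ℝ), 0 < m → ∀ t, (fun x => |U.indicator (u t) x| ^ m)
      = U.indicator fun x => |u t x| ^ m := fun m hm t => by
    ext x
    by_cases hx : x ∈ U
    · simp [hx]
    · simp [hx, Real.zero_rpow hm.ne']
  have h1 : BoundedInLp F 1 := by
    refine ⟨volume.real U + D ^ 2, ?_⟩
    rintro _ ⟨t, ht, rfl⟩
    obtain ⟨h1, h2⟩ := integral_abs_le_of_norm_le hUfin (hD _ (mem_image_of_mem _ ht))
    rw [hpow 1 one_pos t, integrable_indicator_iff hUm, integral_indicator hUm]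
    simpa using ⟨h1, h2⟩
  obtain ⟨C, hC⟩ := boundedInLp_of_lt_criticalExponent hN hs hp hUm hUfin hr hrc (M := M ^ p) (by
    rintro _ ⟨t, ht, rfl⟩
    exact ⟨(hW t ht).1.1, fun x hx => indicator_of_notMem hx _, (hW t ht).2,
      gagliardo_univ_le_of_normW0_le hp (hM t ht)⟩) h1
  refine ⟨C, fun t ht => ?_⟩
  have h2 := hC _ (mem_image_of_mem _ ht)
  rwa [hpow r hr t, integrable_indicator_iff hUm, integral_indicator hUm] at h2

theorem System.logInt_eq (hσ : 2 < S.σ) (u v : Space N → ℝ) :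
    S.logInt u v = ∫ x in S.U, logPow S.σ (u x * v x) * v x * u x := by
  simp only [System.logInt, logPow_mul_mul_eq hσ]

theorem System.logInt_comm (u v : Space N → ℝ) : S.logInt u v = S.logInt v u := by
  refine integral_congr_ae (ae_of_all _ fun x => ?_)
  simp only [mul_comm (u x), mul_comm (|u x| ^ S.σ)]

theorem System.nehari_nonneg_of_norm_eq_zero (hK : S.IsKirchhoff) (hp : 0 < S.p) (hq : 0 < S.q)
    (hσ : 0 < S.σ) (u v : L2 S.U) (h : ‖u‖ ^ 2 + ‖v‖ ^ 2 = 0) : 0 ≤ S.nehari u v := by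
  have h0 : u = 0 := norm_eq_zero.1 (by nlinarith [sq_nonneg ‖u‖, sq_nonneg ‖v‖])
  have hlog0 : S.logInt u v = 0 := by
    rw [System.logInt, integral_congr_ae (g := fun _ => 0), integral_zero]
    filter_upwards [show ⇑u =ᵐ[volume.restrict S.U] 0 by
      rw [h0]; exact Lp.coeFn_zero ℝ 2 _] with x hx
    simp [hx, Real.zero_rpow hσ.ne']
  rw [System.nehari_eq, hlog0]
  have := System.stiffness_nonneg hK hp hq u v
  linarith

/-- Every weak solution with subcritical energy and negative Nehari functional at time zero has
the lifespan bound given by the concavity method. -/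
theorem System.IsWeakSolution.length_le (hN : 0 < N) (hU : S.IsBoundedDomain)
    (hadm : S.Admissible) (hK : S.IsKirchhoff) (hH1 : S.H1) (hH2 : S.H2) {u₀ v₀ : L2 S.U}
    (henergy : S.energy u₀ v₀ < S.depthStar u₀ v₀) (hnehari : S.nehari u₀ v₀ < 0)
    {Tm : ℝ≥0∞} {u v : ℝ → L2 S.U} (hsol : S.IsWeakSolution u₀ v₀ Tm u v) {T : ℝ} (hT : 0 < T)
    (hTm : ENNReal.ofReal T < Tm) :
    T ≤ 4 * (S.σ - 1) * (‖u₀‖ ^ 2 + ‖v₀‖ ^ 2) /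
          (S.σ * (S.depthStar u₀ v₀ - S.energy u₀ v₀) * (S.σ - 2) ^ 2) := by
  obtain ⟨hUo, -, hUb⟩ := hU
  obtain ⟨hs, -, hβ, hp1, hpq, -, -, hmax, -, -, hcrit, -⟩ := hadm
  obtain ⟨-, hW', hM', u', v', hL2, hprim, heq, hen⟩ := hsol
  have hσ2 : 2 < S.σ := (le_max_left _ _).trans_lt hmax
  have hqσ : S.q * (S.β + 1) < S.σ :=
    ((le_max_right _ _).trans (le_max_right _ _)).trans_lt hmax
  have hp : 0 < S.p := by linarith
  have hq : 0 < S.q := by linarith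
  have hσ0 : 0 < S.σ := by linarith
  have hUm : MeasurableSet S.U := hUo.measurableSet
  have hUfin : volume S.U ≠ ⊤ := hUb.measure_lt_top.ne
  have hlt : ∀ t ∈ Icc 0 T, ENNReal.ofReal t < Tm := fun t ht =>
    (ENNReal.ofReal_le_ofReal ht.2).trans_lt hTm
  have hWt : ∀ t ∈ Icc 0 T, (u t, v t) ∈ S.phaseSpace := fun t ht => hW' t ht.1 (hlt t ht)
  obtain ⟨M, hM⟩ := hM' T hTm
  obtain ⟨hu'2, hv'2⟩ := hL2 T hTm
  have hu : ∀ t ∈ Icc 0 T, u t = u₀ + ∫ τ in (0 : ℝ)..t, u' τ := fun t ht =>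
    (hprim t ht.1 (hlt t ht)).1
  have hv : ∀ t ∈ Icc 0 T, v t = v₀ + ∫ τ in (0 : ℝ)..t, v' τ := fun t ht =>
    (hprim t ht.1 (hlt t ht)).2
  have h0T : (0 : ℝ) ∈ Icc 0 T := ⟨le_rfl, hT.le⟩
  have hu0 : u 0 = u₀ := by simpa using hu 0 h0T
  have hv0 : v 0 = v₀ := by simpa using hv 0 h0T
  have huc : ContinuousOn u (Icc 0 T) := fun t ht => tendsto_of_primitive hu'2 hu ht
  have hvc : ContinuousOn v (Icc 0 T) := fun t ht => tendsto_of_primitive hv'2 hv ht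
  obtain ⟨r₁, r₂, hr₁, hr₂, hc₁, hc₂, hgap⟩ :=
    exists_subcritical_exponents hN hs hp hpq hσ0 hcrit
  obtain ⟨C₁, hC₁⟩ := exists_integral_rpow_le hN hUm hUfin hs hp hr₁ hc₁ huc
    (fun t ht => (hWt t ht).1) (fun t ht => (hM t ht).1)
  obtain ⟨C₂, hC₂⟩ := exists_integral_rpow_le hN hUm hUfin hs hq hr₂ hc₂ hvc
    (fun t ht => (hWt t ht).2) (fun t ht => (hM t ht).2)
  have hb₁ : ∀ t ∈ Icc 0 T, IntegrableOn (fun x => |u t x| ^ r₁) S.U ∧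
      ∫ x in S.U, |u t x| ^ r₁ ≤ max C₁ C₂ := fun t ht =>
    ⟨(hC₁ t ht).1, (hC₁ t ht).2.trans (le_max_left _ _)⟩
  have hb₂ : ∀ t ∈ Icc 0 T, IntegrableOn (fun x => |v t x| ^ r₂) S.U ∧
      ∫ x in S.U, |v t x| ^ r₂ ≤ max C₁ C₂ := fun t ht =>
    ⟨(hC₂ t ht).1, (hC₂ t ht).2.trans (le_max_right _ _)⟩
  have hequ : ∀ᵐ τ : ℝ, τ ∈ Ioc 0 T → ∀ w : L2 S.U, MemW0 S.U S.s S.p w →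
      inner ℝ (u' τ) w + S.K (S.bracket S.p (u τ)) * S.fracLaplacePairing S.p (u τ) w
        = ∫ x in S.U, logPow S.σ (u τ x * v τ x) * v τ x * w x := by
    filter_upwards [heq] with τ hτ hτT w hw
    rw [(hτ hτT.1 (hlt τ ⟨hτT.1.le, hτT.2⟩)).1 w hw]
    simp only [logPow_mul_eq hσ2]
  have heqv : ∀ᵐ τ : ℝ, τ ∈ Ioc 0 T → ∀ w : L2 S.U, MemW0 S.U S.s S.q w →
      inner ℝ (v' τ) w + S.K (S.bracket S.q (v τ)) * S.fracLaplacePairing S.q (v τ) w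
        = ∫ x in S.U, logPow S.σ (v τ x * u τ x) * u τ x * w x := by
    filter_upwards [heq] with τ hτ hτT w hw
    rw [(hτ hτT.1 (hlt τ ⟨hτT.1.le, hτT.2⟩)).2 w hw]
    simp only [mul_comm (u τ _) (v τ _), logPow_mul_eq hσ2]
  set Pu : ℝ → ℝ := fun t =>
    S.logInt (u t) (v t) - S.K (S.bracket S.p (u t)) * gagliardo S.U S.s S.p (u t) with hPu
  set Pv : ℝ → ℝ := fun t =>
    S.logInt (u t) (v t) - S.K (S.bracket S.q (v t)) * gagliardo S.U S.s S.q (v t) with hPv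
  have hderu : ∀ t ∈ Icc 0 T, HasDerivWithinAt (fun t => ‖u t‖ ^ 2 / 2) (Pu t) (Icc 0 T) t := by
    intro t ht
    have hP : Pu t = (∫ x in S.U, logPow S.σ (u t x * v t x) * v t x * u t x)
        - S.K (S.bracket S.p (u t)) * gagliardo S.U S.s S.p (u t) := by
      rw [← System.logInt_eq hσ2]
    rw [hP]
    exact S.hasDerivWithinAt_half_norm_sq hUm hUfin hσ2 hp1 hK.1 (hH1.monotoneOn_Ici hK)
      (fun z hz => hK.nonneg hz) hr₁ hr₂ hgap hu'2 hu ht (hvc t ht)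
      (fun t ht => (hWt t ht).1) hb₁ hb₂ hequ
  have hderv : ∀ t ∈ Icc 0 T, HasDerivWithinAt (fun t => ‖v t‖ ^ 2 / 2) (Pv t) (Icc 0 T) t := by
    intro t ht
    have hP : Pv t = (∫ x in S.U, logPow S.σ (v t x * u t x) * u t x * v t x)
        - S.K (S.bracket S.q (v t)) * gagliardo S.U S.s S.q (v t) := by
      rw [← System.logInt_eq hσ2, System.logInt_comm]
    rw [hP]
    exact S.hasDerivWithinAt_half_norm_sq hUm hUfin hσ2 (hp1.trans hpq) hK.1
      (hH1.monotoneOn_Ici hK) (fun z hz => hK.nonneg hz) hr₂ hr₁ (by rwa [add_comm]) hv'2 hv ht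
      (huc t ht) (fun t ht => (hWt t ht).2) hb₂ hb₁ heqv
  have hPu_ae : ∀ᵐ τ : ℝ, τ ∈ Ioc 0 T → inner ℝ (u' τ) (u τ) = Pu τ := by
    filter_upwards [hequ] with τ hτ hτT
    have := hτ hτT (u τ) (hWt τ ⟨hτT.1.le, hτT.2⟩).1
    rw [S.fracLaplacePairing_self hp1, ← System.logInt_eq hσ2] at this
    simp only [hPu]; linarith
  have hPv_ae : ∀ᵐ τ : ℝ, τ ∈ Ioc 0 T → inner ℝ (v' τ) (v τ) = Pv τ := by
    filter_upwards [heqv] with τ hτ hτT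
    have := hτ hτT (v τ) (hWt τ ⟨hτT.1.le, hτT.2⟩).2
    rw [S.fracLaplacePairing_self (hp1.trans hpq), ← System.logInt_eq hσ2,
      System.logInt_comm] at this
    simp only [hPv]; linarith
  have hsum : ∀ t, Pu t + Pv t = -S.nehari (u t) (v t) := fun t => by
    rw [System.nehari_eq, System.stiffness]; simp only [hPu, hPv]; ring
  set Q : ℝ → ℝ := fun t => ∫ τ in (0 : ℝ)..t, (‖u' τ‖ ^ 2 + ‖v' τ‖ ^ 2) with hQ
  have hQnn : ∀ t ∈ Icc 0 T, 0 ≤ Q t := fun t ht =>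
    intervalIntegral.integral_nonneg ht.1 fun τ _ => by positivity
  set gap := S.depthStar u₀ v₀ - S.energy u₀ v₀ with hgapdef
  have hgap0 : 0 < gap := sub_pos.2 henergy
  have hkey : ∀ t ∈ Icc 0 T, S.nehari (u t) (v t) < 0 →
      S.σ * (gap + Q t) ≤ -S.nehari (u t) (v t) := fun t ht hneg => by
    have h1 := System.mul_depthStar_le hUfin hUm hK hH1 hH2 hβ hp hpq.le hqσ u₀ v₀ (hWt t ht) hneg
    have h2 := mul_le_mul_of_nonneg_left (hen t ht.1 (hlt t ht)) hσ0.le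
    simp only [hgapdef, hQ]
    simp only at h1
    linarith
  -- Darboux: if `-ψ` left the positive range, the derivative of half the squared norm would take
  -- the value `σ gap / 2`, where `ψ < 0` and `hkey` would force at least `σ gap`.
  have hneg : ∀ t ∈ Icc 0 T, S.nehari (u t) (v t) < 0 := by
    intro t ht
    by_contra! hcon
    have hsub : Icc 0 t ⊆ Icc 0 T := Icc_subset_Icc_right ht.2
    have h1 := hkey 0 h0T (by rwa [hu0, hv0])
    have h2 := mul_le_mul_of_nonneg_left (hQnn 0 h0T) hσ0.le
    have hσgap : 0 < S.σ * gap := by positivity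
    obtain ⟨c, hc, hceq⟩ := exists_hasDerivWithinAt_eq_of_lt_of_gt (m := S.σ * gap / 2) ht.1
      (f := fun t => ‖u t‖ ^ 2 / 2 + ‖v t‖ ^ 2 / 2) (f' := fun t => Pu t + Pv t)
      (fun x hx => ((hderu x (hsub hx)).mono hsub).add ((hderv x (hsub hx)).mono hsub))
      (by rw [hsum]; linarith) (by rw [hsum]; linarith)
    have hcT : c ∈ Icc 0 T := hsub (Ioo_subset_Icc_self hc)
    simp only [hsum] at hceq
    have h3 := hkey c hcT (by linarith)
    have h4 := mul_nonneg hσ0.le (hQnn c hcT)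
    linarith
  -- This `b` solves `σ b = σ gap + b`, which turns `hkey` into the hypothesis `σ (Q + b) ≤ P + b`
  -- of the concavity lemma.
  have hb0 : 0 < S.σ * gap / (S.σ - 1) := div_pos (by positivity) (by linarith)
  have hyint : ∀ {w : ℝ → L2 S.U}, ContinuousOn w (Icc 0 T) → ∀ t ∈ Icc 0 T,
      IntervalIntegrable (fun τ => ‖w τ‖ ^ 2) volume 0 t := fun hw t ht =>
    ((hw.norm.pow 2).mono (Icc_subset_Icc_right ht.2)).intervalIntegrable_of_Icc ht.1
  have hqint : ∀ {w : ℝ → L2 S.U}, MemLp w 2 (volume.restrict (Ioc 0 T)) → ∀ t ∈ Icc 0 T,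
      IntervalIntegrable (fun τ => ‖w τ‖ ^ 2) volume 0 t := fun hw t ht =>
    (intervalIntegrable_iff_integrableOn_Ioc_of_le ht.1).2
      (IntegrableOn.mono_set (hw.integrable_norm_pow two_ne_zero) (Ioc_subset_Ioc_right ht.2))
  have hfin := length_le_of_concavity (y := fun t => ‖u t‖ ^ 2 + ‖v t‖ ^ 2)
    (P := fun t => Pu t + Pv t) (Q := Q) hT hσ2 hb0 ?_ (fun t => by positivity) ?_ ?_ hQnn ?_
  · simp only [hu0, hv0] at hfin
    refine hfin.trans (le_of_eq ?_)
    have h1 : S.σ - 1 ≠ 0 := by linarith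
    have h2 : S.σ - 2 ≠ 0 := by linarith
    field_simp
  -- Zero initial data would make the logarithmic integral vanish, hence `ψ ≥ 0`.
  · refine lt_of_le_of_ne (by positivity) fun h0 => ?_
    have := System.nehari_nonneg_of_norm_eq_zero hK hp hq hσ0 _ _ h0.symm
    exact absurd (hneg 0 h0T) (not_lt.2 this)
  · intro t ht
    have h := ((hderu t ht).add (hderv t ht)).const_mul 2
    refine h.congr_of_mem (fun x _ => ?_) ht
    simp only [Pi.add_apply]; ring
  · intro t ht x
    have h1 := quadratic_form_nonneg_of_primitive hu'2 hu hderu hPu_ae ht x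
    have h2 := quadratic_form_nonneg_of_primitive hv'2 hv hderv hPv_ae ht x
    simp only [hQ]
    rw [intervalIntegral.integral_add (hyint huc t ht) (hyint hvc t ht),
      intervalIntegral.integral_add (hqint hu'2 t ht) (hqint hv'2 t ht)]
    linarith
  · intro t ht
    simp only [hsum]
    have h1 := hkey t ht (hneg t ht)
    have h2 : S.σ * (S.σ * gap / (S.σ - 1)) = S.σ * gap + S.σ * gap / (S.σ - 1) := by
      have h1 : S.σ - 1 ≠ 0 := by linarith
      field_simp
      ring
    linarith

end WeakSolution

end FracKirchhoff

theorem theorem5p1 {N : ℕ} (hN : 0 < N) (S : FracKirchhoff.System N)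
    (hU : S.IsBoundedDomain) (hadm : S.Admissible) (hK : S.IsKirchhoff)
    (hH1 : S.H1) (hH2 : S.H2)
    (u₀ v₀ : FracKirchhoff.L2 S.U) (hY : (u₀, v₀) ∈ S.phaseSpace)
    (henergy : S.energy u₀ v₀ < S.depthStar u₀ v₀)
    (hnehari : S.nehari u₀ v₀ < 0) :
    S.Tmax u₀ v₀ < ⊤ ∧
      S.Tmax u₀ v₀ ≤ ENNReal.ofReal
        (4 * (S.σ - 1) * (‖u₀‖ ^ 2 + ‖v₀‖ ^ 2) /
          (S.σ * (S.depthStar u₀ v₀ - S.energy u₀ v₀) * (S.σ - 2) ^ 2)) := by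
  have hle : S.Tmax u₀ v₀ ≤ ENNReal.ofReal
      (4 * (S.σ - 1) * (‖u₀‖ ^ 2 + ‖v₀‖ ^ 2) /
        (S.σ * (S.depthStar u₀ v₀ - S.energy u₀ v₀) * (S.σ - 2) ^ 2)) := by
    refine sSup_le ?_
    rintro T ⟨u, v, hsol⟩
    by_contra! hlt
    -- The lifespan may be infinite, so the bound is applied at a finite time strictly between the
    -- claimed bound and `T`.
    obtain ⟨t, h1, h2⟩ := ENNReal.lt_iff_exists_nnreal_btwn.1 hlt
    rw [← ENNReal.ofReal_coe_nnreal] at h1 h2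
    have ht : (0 : ℝ) < t := by
      by_contra! h0
      rw [ENNReal.ofReal_of_nonpos h0] at h1
      exact not_lt_zero h1
    have h3 := hsol.length_le hN hU hadm hK hH1 hH2 henergy hnehari ht h2
    exact absurd h1 (not_lt.2 (ENNReal.ofReal_le_ofReal h3))
  exact ⟨hle.trans_lt ENNReal.ofReal_lt_top, hle⟩
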